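/- Let $d\ge 2$, $k\ge 1$. Let $\lambda$ be the surface measure on $\mathbb{S}^{d-1}\subset\mathbb{R}^d$, $|\mathbb{S}^{d-1}|=\lambda(\mathbb{S}^{d-1})$, $\tau=\lambda/|\mathbb{S}^{d-1}|$, and $e_d$ the last vector of the canonical basis. There is a unique homogeneous harmonic polynomial $L_{k,d}$ of degree $k$ on $\mathbb{R}^d$ (the Legendre harmonic) that is invariant under all orthogonal maps fixing $e_d$ and satisfies $L_{k,d}(e_d)=1$; put $P_{k,d}(t)=L_{k,d}\bigl(te_d+(1-t^2)^{1/2}\xi\bigr)$ for $t\in[-1,1]$ and any unit $\xi\perp e_d$. Put $\gamma_{k,d}=2\left(\int|L_{k,d}|\,d\tau\right)^{-1}$, and let $\mu_d,\nu_d$ be the measures on $\mathbb{S}^{d-1}$ whose densities with respect to $\lambda$ are $\frac{\gamma_{k,d}}{|\mathbb{S}^{d-1}|}\max(L_{k,d},0)$ and $\frac{\gamma_{k,d}}{|\mathbb{S}^{d-1}|}\max(-L_{k,d},0)$; these are probability measures. Let $N_{k,d}$ be the dimension of the space of spherical harmonics of order $k$ on $\mathbb{S}^{d-1}$. Let $\sigma:\mathbb{R}\to\mathbb{R}$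 be a Borel measurable function that is bounded on $[-1,1]$. Let $\mathcal{F}_1$ be the space of functions $f(x)=\int_{\mathbb{S}^{d-1}}\sigma(\langle\theta,x\rangle)\,d\gamma(\theta)$ on $\mathbb{S}^{d-1}$ with $\gamma$ a finite signed measure, normed by the infimum of $\|\gamma\|_{\mathrm{TV}}$ over all such $\gamma$; let $\mathcal{F}_2$ be the space of functions $f(x)=\int_{\mathbb{S}^{d-1}}\sigma(\langle\theta,x\rangle)h(\theta)\,d\tau(\theta)$ with $h\in L^2(\tau)$, where $\|f\|_{\mathcal{F}_2}^2$ is the infimum of $\int h^2\,d\tau$ over all such $h$. For $i=1,2$ let $$d_{\mathcal{B}_{\mathcal{F}_i}}(\mu_d,\nu_d)=\sup_{\|f\|_{\mathcal{F}_i}\le 1}\left(\int f\,d\mu_d-\int f\,d\nu_d\right).$$ Both suprema are finite, and $$d_{\mathcal{B}_{\mathcal{F}_1}}(\mu_d,\nu_d)=\frac{2\left|\int_{-1}^1P_{k,d}(t)\sigma(t)(1-t^2)^{\frac{d-3}{2}}dt\right|}{\int_{-1}^1|P_{k,d}(t)|(1-t^2)^{\frac{d-3}{2}}dt},\qquad d_{\mathcal{B}_{\mathcal{F}_1}}(\mu_d,\nu_d)=\sqrt{N_{k,d}}\;d_{\mathcal{B}_{\mathcal{F}_2}}(\mu_d,\nu_d),\qquad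 N_{k,d}=\frac{(2k+d-2)(k+d-3)!}{k!\,(d-2)!}.$$ Suppose moreover that $\int_{-1}^1P_{k,d}(t)\sigma(t)(1-t^2)^{\frac{d-3}{2}}dt\ne0$. Then $d_{\mathcal{B}_{\mathcal{F}_2}}(\mu_d,\nu_d)>0$ and $$\frac{d_{\mathcal{B}_{\mathcal{F}_1}}(\mu_d,\nu_d)}{d_{\mathcal{B}_{\mathcal{F}_2}}(\mu_d,\nu_d)}=\sqrt{N_{k,d}}.$$ Under this condition, if $k+d\ge4$, then $$\log\left(\frac{d_{\mathcal{B}_{\mathcal{F}_1}}(\mu_d,\nu_d)}{d_{\mathcal{B}_{\mathcal{F}_2}}(\mu_d,\nu_d)}\right)=\frac12\left(k\log\left(\frac{k+d-3}{k}\right)+(d-2)\log\left(\frac{k+d-3}{d-2}\right)\right)+O(\log(k+d)),$$ where the constant in $O$ is absolute (independent of $k,d,\sigma$) and the second term is read as $0$ when $d=2$. In particular, for all $0<c_1\le c_2$ there are $a,b>0$, depending only on $c_1,c_2$, such that for all $d\ge2$, $k\ge1$ with $c_1d\le k\le c_2d$ and all such $\sigma$ (with nonzero integral), the ratio of the two distances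 lies between $e^{ad}$ and $e^{bd}$. -/

import Mathlib

open MeasureTheory Set
open scoped Nat RealInnerProductSpace

noncomputable section

namespace SphereIPM

/-- The Euclidean space `ℝ^d`. -/
abbrev E (d : ℕ) : Type := EuclideanSpace ℝ (Fin d)

/-- The unit sphere `𝕊^{d-1}` of `ℝ^d`. -/
abbrev S (d : ℕ) : Type := Metric.sphere (0 : E d) 1

/-! ### Surface measure -/

/-- The surface (Hausdorff) measure on `𝕊^{d-1}`, the one given by polar coordinates. -/
def surf (d : ℕ) : Measure (S d) := (volume : Measure (E d)).toSphere

/-- The total surface area `|𝕊^{d-1}|`. -/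
def area (d : ℕ) : ℝ := (surf d).real univ

/-- The uniform probability measure on `𝕊^{d-1}`. -/
def unif (d : ℕ) : Measure (S d) := (surf d univ)⁻¹ • surf d

/-! ### Spherical harmonics, Legendre harmonics, Legendre polynomials -/

/-- The Laplacian `∑ᵢ ∂ᵢ²` on real polynomials in `d` variables. -/
def polyLaplacian (d : ℕ) : MvPolynomial (Fin d) ℝ →ₗ[ℝ] MvPolynomial (Fin d) ℝ :=
  ∑ i, (MvPolynomial.pderiv i).toLinearMap ∘ₗ (MvPolynomial.pderiv i).toLinearMap

/-- Homogeneous harmonic polynomials of degree `k` in `d` variables. -/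
def harmonicPoly (d k : ℕ) : Submodule ℝ (MvPolynomial (Fin d) ℝ) :=
  MvPolynomial.homogeneousSubmodule (Fin d) ℝ k ⊓ LinearMap.ker (polyLaplacian d)

/-- Restriction of a polynomial to the sphere. -/
def restrictSphere (d : ℕ) : MvPolynomial (Fin d) ℝ →ₗ[ℝ] (S d → ℝ) where
  toFun p x := MvPolynomial.eval (x : E d) p
  map_add' p q := by ext x; simp
  map_smul' c p := by ext x; simp

/-- Spherical harmonics of order `k` on `𝕊^{d-1}`: the restrictions to the sphere of the
homogeneous harmonic polynomials of degree `k`. -/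
def sphericalHarmonics (d k : ℕ) : Submodule ℝ (S d → ℝ) :=
  (harmonicPoly d k).map (restrictSphere d)

/-- `N_{k,d}`, the dimension of the space of spherical harmonics of order `k` on `𝕊^{d-1}`. -/
def N (d k : ℕ) : ℕ := Module.finrank ℝ (sphericalHarmonics d k)

/-- The last vector `e_d` of the canonical basis of `ℝ^d`. -/
def eLast (d : ℕ) : E d := WithLp.toLp 2 fun i => if (i : ℕ) + 1 = d then 1 else 0

/-- The first vector `e_1` of the canonical basis of `ℝ^d`. -/
def eFirst (d : ℕ) : E d := WithLp.toLp 2 fun i => if (i : ℕ) = 0 then 1 else 0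

/-- `L` is a homogeneous harmonic polynomial of degree `k`, invariant under every orthogonal
transformation that fixes `e_d`, with `L(e_d) = 1`. -/
structure IsLegendreHarmonic (d k : ℕ) (L : MvPolynomial (Fin d) ℝ) : Prop where
  mem : L ∈ harmonicPoly d k
  invariant : ∀ A : E d ≃ₗᵢ[ℝ] E d, A (eLast d) = eLast d →
    ∀ x : E d, MvPolynomial.eval (A x) L = MvPolynomial.eval x L
  normalized : MvPolynomial.eval (eLast d) L = 1

/-- The Legendre harmonic `L_{k,d}`: the polynomial with the defining properties
`IsLegendreHarmonic`. -/
def legendreHarmonic (d k : ℕ) : MvPolynomial (Fin d) ℝ :=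
  Classical.epsilon (IsLegendreHarmonic d k)

/-- The value `L_{k,d}(x)` at a point of the sphere. -/
def L (d k : ℕ) (x : S d) : ℝ := MvPolynomial.eval (x : E d) (legendreHarmonic d k)

/-- The Legendre polynomial, `P_{k,d}(t) = L_{k,d}(t e_d + (1 - t²)^{1/2} ξ)` for a unit vector
`ξ ⊥ e_d`; here `ξ = e_1`, and `eval_slice_eq` shows that any other choice gives the same value. -/
def P (d k : ℕ) (t : ℝ) : ℝ :=
  MvPolynomial.eval (t • eLast d + √(1 - t ^ 2) • eFirst d : E d) (legendreHarmonic d k)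

/-- A Legendre harmonic takes the same value at `t e_d + (1 - t²)^{1/2} ξ` for all unit vectors
`ξ ⊥ e_d`. -/
theorem eval_slice_eq {d k : ℕ} {p : MvPolynomial (Fin d) ℝ} (hp : IsLegendreHarmonic d k p)
    {ξ η : E d} (hξ : ‖ξ‖ = 1) (hη : ‖η‖ = 1) (hξe : ⟪ξ, eLast d⟫ = 0) (hηe : ⟪η, eLast d⟫ = 0)
    (t : ℝ) :
    MvPolynomial.eval (t • eLast d + √(1 - t ^ 2) • ξ : E d) p =
      MvPolynomial.eval (t • eLast d + √(1 - t ^ 2) • η : E d) p := by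
  have h1 : (ℝ ∙ (ξ - η))ᗮ.reflection ξ = η := Submodule.reflection_sub (by rw [hξ, hη])
  have h2 : (ℝ ∙ (ξ - η))ᗮ.reflection (eLast d) = eLast d := by
    rw [Submodule.reflection_eq_self_iff, Submodule.mem_orthogonal_singleton_iff_inner_right]
    rw [inner_sub_left, hξe, hηe, sub_zero]
  have h := hp.invariant (ℝ ∙ (ξ - η))ᗮ.reflection h2 (t • eLast d + √(1 - t ^ 2) • ξ)
  rw [map_add, map_smul, map_smul, h1, h2] at h
  exact h.symm

/-- `∫_{-1}^{1} f(t) (1 - t²)^{(d-3)/2} dt`. -/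
def weightedIntegral (d : ℕ) (f : ℝ → ℝ) : ℝ :=
  ∫ t in (-1 : ℝ)..1, f t * (1 - t ^ 2) ^ (((d : ℝ) - 3) / 2)

/-! ### The pair of measures -/

/-- The normalizing constant `γ_{k,d} = 2 (∫ |L_{k,d}| dτ)⁻¹`. -/
def gammaConst (d k : ℕ) : ℝ := 2 * (∫ x, |L d k x| ∂(unif d))⁻¹

open Classical in
/-- `μ_d`: density `γ L / |𝕊^{d-1}|` where `L > 0`, and `0` elsewhere. -/
def muMeas (d k : ℕ) : Measure (S d) :=
  (surf d).withDensity fun x =>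
    if 0 < L d k x then ENNReal.ofReal (gammaConst d k * L d k x / area d) else 0

open Classical in
/-- `ν_d`: density `-γ L / |𝕊^{d-1}|` where `L ≤ 0`, and `0` elsewhere. -/
def nuMeas (d k : ℕ) : Measure (S d) :=
  (surf d).withDensity fun x =>
    if 0 < L d k x then 0 else ENNReal.ofReal (-gammaConst d k * L d k x / area d)

/-! ### The function classes and their integral probability metrics -/

/-- Integral of a function against a signed measure, through its Jordan decomposition. -/
def signedIntegral {X : Type*} [MeasurableSpace X] (γ : SignedMeasure X) (f : X → ℝ) : ℝ :=
  (∫ x, f x ∂γ.toJordanDecomposition.posPart) - ∫ x, f x ∂γ.toJordanDecomposition.negPart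

/-- The total variation norm of a signed measure. -/
def tvNorm {X : Type*} [MeasurableSpace X] (γ : SignedMeasure X) : ℝ :=
  γ.totalVariation.real univ

/-- `f(x) = ∫ σ(⟨θ, x⟩) dγ(θ)` for all `x ∈ 𝕊^{d-1}`. -/
def F1Rep (d : ℕ) (σ : ℝ → ℝ) (f : S d → ℝ) (γ : SignedMeasure (S d)) : Prop :=
  ∀ x : S d, f x = signedIntegral γ fun θ => σ ⟪(θ : E d), (x : E d)⟫

/-- The space `𝓕₁` of functions on `𝕊^{d-1}`. -/
def F1 (d : ℕ) (σ : ℝ → ℝ) : Set (S d → ℝ) := {f | ∃ γ, F1Rep d σ f γ}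

/-- The norm of `𝓕₁` (meaningful on `𝓕₁`). -/
def F1norm (d : ℕ) (σ : ℝ → ℝ) (f : S d → ℝ) : ℝ := sInf {r | ∃ γ, F1Rep d σ f γ ∧ r = tvNorm γ}

/-- The closed unit ball of `𝓕₁`. -/
def F1ball (d : ℕ) (σ : ℝ → ℝ) : Set (S d → ℝ) := {f ∈ F1 d σ | F1norm d σ f ≤ 1}

/-- `f(x) = ∫ σ(⟨θ, x⟩) h(θ) dτ(θ)` for all `x ∈ 𝕊^{d-1}`, with `h ∈ L²(τ)`. -/
def F2Rep (d : ℕ) (σ : ℝ → ℝ) (f : S d → ℝ) (h : S d → ℝ) : Prop :=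
  MemLp h 2 (unif d) ∧
    ∀ x : S d, f x = ∫ θ, σ ⟪(θ : E d), (x : E d)⟫ * h θ ∂(unif d)

/-- The space `𝓕₂` of functions on `𝕊^{d-1}`. -/
def F2 (d : ℕ) (σ : ℝ → ℝ) : Set (S d → ℝ) := {f | ∃ h, F2Rep d σ f h}

/-- The norm of `𝓕₂` (meaningful on `𝓕₂`). -/
def F2norm (d : ℕ) (σ : ℝ → ℝ) (f : S d → ℝ) : ℝ :=
  √(sInf {r | ∃ h, F2Rep d σ f h ∧ r = ∫ θ, h θ ^ 2 ∂(unif d)})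

/-- The closed unit ball of `𝓕₂`. -/
def F2ball (d : ℕ) (σ : ℝ → ℝ) : Set (S d → ℝ) := {f ∈ F2 d σ | F2norm d σ f ≤ 1}

/-- The values `𝔼_μ f - 𝔼_ν f`, `f ∈ F`. -/
def ipmValues {X : Type*} [MeasurableSpace X] (F : Set (X → ℝ)) (μ ν : Measure X) : Set ℝ :=
  (fun f : X → ℝ => (∫ x, f x ∂μ) - ∫ x, f x ∂ν) '' F

/-- The integral probability metric `d_F(μ, ν) = sup_{f ∈ F} (𝔼_μ f - 𝔼_ν f)`. -/
def ipm {X : Type*} [MeasurableSpace X] (F : Set (X → ℝ)) (μ ν : Measure X) : ℝ :=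
  sSup (ipmValues F μ ν)

/-- `d_{𝓑_{𝓕₁}}(μ_d, ν_d)`. -/
def d1 (d k : ℕ) (σ : ℝ → ℝ) : ℝ := ipm (F1ball d σ) (muMeas d k) (nuMeas d k)

/-- `d_{𝓑_{𝓕₂}}(μ_d, ν_d)`. -/
def d2 (d k : ℕ) (σ : ℝ → ℝ) : ℝ := ipm (F2ball d σ) (muMeas d k) (nuMeas d k)

/-- A (Borel measurable) activation function that is bounded on `[-1, 1]`. -/
structure IsBoundedActivation (σ : ℝ → ℝ) : Prop where
  measurable : Measurable σ
  bounded : ∃ M : ℝ, ∀ t ∈ Icc (-1 : ℝ) 1, |σ t| ≤ M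

end SphereIPM

end

noncomputable section

namespace SphereIPM

/-! ### Harmonic polynomials: coefficients and dimension -/

/-! The difference `μ_d - ν_d` has density `γ L` with respect to `τ`, so both distances are norms of
the functional `f ↦ γ ∫ f L dτ`. If `f` is represented by a signed measure `m`, Fubini and the
Funk–Hecke formula `∫ σ(⟨θ, x⟩) L(x) dτ(x) = λ L(θ)` turn its value into `γ λ ∫ L dm`, whatever
representation is chosen. The supremum over the total variation ball is then `γ |λ| max |L| = γ
|λ|`, reached at a signed Dirac mass at the pole; over the `L²` ball it is `γ |λ| ‖L‖₂ = γ |λ| /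
√N`, reached at a multiple of `L`. The ratio is therefore `√N`.

The facts `max |L| = 1`, `‖L‖₂² = 1 / N` and Funk–Hecke share one source. Harmonic polynomials of
degree `k` have a reproducing kernel for the `L²` product on the sphere; the kernel at `e_d` is
zonal and takes the value `N` at `e_d`. Zonal harmonics form a line, so this kernel is `N L`, and
every functional invariant under the stabilizer of `e_d` is a multiple of evaluation at `e_d`. The
line property is algebraic: a harmonic polynomial is determined by its values and its normal
derivative on the hyperplane `e_dᗮ`; for a zonal one, each is known from a single point, and parity
kills one of the two.

The dimension `N` comes from two opposite inequalities, rank–nullity for the Laplacian and a count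
of determining coefficients. Polar coordinates give the law of the last coordinate on the sphere,
hence the integrals with weight `(1 - t²)^((d-3)/2)`. Elementary Stirling and binomial bounds on `N`
give the asymptotics. -/

theorem polyLaplacian_apply {d : ℕ} (p : MvPolynomial (Fin d) ℝ) :
    polyLaplacian d p = ∑ i, MvPolynomial.pderiv i (MvPolynomial.pderiv i p) := by
  simp [polyLaplacian]

theorem coeff_polyLaplacian {d : ℕ} (p : MvPolynomial (Fin d) ℝ) (α : Fin d →₀ ℕ) :
    MvPolynomial.coeff α (polyLaplacian d p) =
      ∑ i, ((α i : ℝ) + 1) * ((α i : ℝ) + 2) * MvPolynomial.coeff (α + Finsupp.single i 2) p := by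
  rw [polyLaplacian_apply, MvPolynomial.coeff_sum]
  refine Finset.sum_congr rfl fun i _ => ?_
  rw [MvPolynomial.coeff_pderiv, MvPolynomial.coeff_pderiv, add_assoc, ← Finsupp.single_add]
  simp only [Finsupp.add_apply, Finsupp.single_eq_same]
  push_cast
  ring

/-- A harmonic polynomial is determined by its coefficients of degree at most one in one of the
variables. -/
theorem eq_zero_of_harmonic_of_coeff {d : ℕ} (l : Fin d) {p : MvPolynomial (Fin d) ℝ}
    (hp : polyLaplacian d p = 0) (h : ∀ α : Fin d →₀ ℕ, α l ≤ 1 → MvPolynomial.coeff α p = 0) :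
    p = 0 := by
  have key : ∀ m : ℕ, ∀ α : Fin d →₀ ℕ, α l = m → MvPolynomial.coeff α p = 0 := by
    intro m
    induction m using Nat.strong_induction_on with
    | _ m ih =>
      intro α hα
      by_cases hm : m ≤ 1
      · exact h α (hα.trans_le hm)
      · have h2 : Finsupp.single l 2 ≤ α := by
          rw [Finsupp.single_le_iff]; omega
        set β := α - Finsupp.single l 2 with hβ
        have hαβ : β + Finsupp.single l 2 = α := tsub_add_cancel_of_le h2
        have hβl : β l + 2 = m := by
          rw [← hα, ← hαβ]; simp
        have hc := coeff_polyLaplacian p β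
        rw [hp, MvPolynomial.coeff_zero, Finset.sum_eq_single l] at hc
        · rw [hαβ] at hc
          have : ((β l : ℝ) + 1) * ((β l : ℝ) + 2) ≠ 0 := by positivity
          exact (mul_eq_zero.1 hc.symm).resolve_left this
        -- For `i ≠ l` the coefficient at `β + 2 e_i` has `l`-exponent `m - 2`, so it vanishes by
        -- induction.
        · intro i _ hi
          rw [ih (β l) (by omega) (β + Finsupp.single i 2) (by simp [hi]), mul_zero]
        · simp
  ext α
  exact key _ α rfl

/-! ### Monomial counts and the dimension of the space of harmonic polynomials. -/

theorem finite_degree_eq (d k : ℕ) : {α : Fin d →₀ ℕ | α.degree = k}.Finite := by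
  refine ((Finset.univ : Finset (Fin d)).finsuppAntidiag k).finite_toSet.subset fun α hα => ?_
  have : α.degree = k := hα
  simpa [Finset.mem_finsuppAntidiag, Finsupp.degree_eq_sum] using this

theorem ncard_degree_eq (d k : ℕ) :
    {α : Fin d →₀ ℕ | α.degree = k}.ncard = (d + k - 1).choose k := by
  have : {α : Fin d →₀ ℕ | α.degree = k} =
      ((Finset.univ : Finset (Fin d)).finsuppAntidiag k : Set (Fin d →₀ ℕ)) := by
    ext α
    simp [Finset.mem_finsuppAntidiag, Finsupp.degree_eq_sum]
  rw [this, Set.ncard_coe_finset, Finset.card_finsuppAntidiag_nat_eq_choose]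
  simp

instance finite_homogeneousSubmodule (d k : ℕ) :
    Module.Finite ℝ (MvPolynomial.homogeneousSubmodule (Fin d) ℝ k) :=
  Module.Finite.iff_fg.2 (MvPolynomial.homogeneousSubmodule_fg _ _ k)

instance finite_harmonicPoly (d k : ℕ) : Module.Finite ℝ (harmonicPoly d k) :=
  Submodule.finiteDimensional_of_le (inf_le_left :
    harmonicPoly d k ≤ MvPolynomial.homogeneousSubmodule (Fin d) ℝ k)

theorem finrank_homogeneousSubmodule (d k : ℕ) :
    Module.finrank ℝ (MvPolynomial.homogeneousSubmodule (Fin d) ℝ k) = (d + k - 1).choose k := by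
  rw [MvPolynomial.homogeneousSubmodule_eq_finsupp_supported, ← ncard_degree_eq]
  have := (finite_degree_eq d k).fintype
  refine (AddMonoidAlgebra.supportedEquivFinsupp (R := ℝ) (S := ℝ)
    {α : Fin d →₀ ℕ | α.degree = k}).finrank_eq.trans ?_
  rw [Module.finrank_finsupp_self, ← Nat.card_eq_fintype_card]
  rfl

theorem isHomogeneous_polyLaplacian {d k : ℕ} {p : MvPolynomial (Fin d) ℝ}
    (hp : p.IsHomogeneous k) : (polyLaplacian d p).IsHomogeneous (k - 2) := by
  rw [polyLaplacian_apply]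
  exact MvPolynomial.IsHomogeneous.sum _ _ _ fun i _ => hp.pderiv.pderiv

/-- Rank–nullity for the Laplacian from degree `k + 2` to degree `k`: the lower bound on the
harmonic dimension. -/
theorem finrank_homogeneous_le (d k : ℕ) :
    Module.finrank ℝ (MvPolynomial.homogeneousSubmodule (Fin d) ℝ (k + 2)) ≤
      Module.finrank ℝ (harmonicPoly d (k + 2)) +
        Module.finrank ℝ (MvPolynomial.homogeneousSubmodule (Fin d) ℝ k) := by
  let f : MvPolynomial.homogeneousSubmodule (Fin d) ℝ (k + 2) →ₗ[ℝ]
      MvPolynomial.homogeneousSubmodule (Fin d) ℝ k :=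
    (polyLaplacian d).restrict fun p hp => isHomogeneous_polyLaplacian hp
  have h := LinearMap.finrank_range_add_finrank_ker f
  have h1 : Module.finrank ℝ (LinearMap.range f) ≤ _ := Submodule.finrank_le _
  let g : LinearMap.ker f →ₗ[ℝ] harmonicPoly d (k + 2) :=
    { toFun := fun p => ⟨p.1.1, p.1.2, by
        have := p.2
        rw [LinearMap.mem_ker] at this
        exact congrArg Subtype.val this⟩
      map_add' := fun _ _ => rfl
      map_smul' := fun _ _ => rfl }
  have h2 := LinearMap.finrank_le_finrank_of_injective (f := g) fun p q hpq =>
    Subtype.ext (Subtype.ext (congrArg (fun r => r.1) hpq))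
  omega

/-- The coefficients with `l`-exponent at most one determine a harmonic polynomial, so reading them
off is injective: the upper bound. -/
theorem finrank_harmonicPoly_le (d k : ℕ) (l : Fin d) :
    Module.finrank ℝ (harmonicPoly d k) ≤
      {α : Fin d →₀ ℕ | α.degree = k ∧ α l ≤ 1}.ncard := by
  set s := {α : Fin d →₀ ℕ | α.degree = k ∧ α l ≤ 1} with hs
  have hfin : s.Finite := (finite_degree_eq d k).subset fun α h => h.1
  have := hfin.fintype
  let f : harmonicPoly d k →ₗ[ℝ] (s → ℝ) :=
    { toFun := fun p α => MvPolynomial.coeff α.1 p.1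
      map_add' := fun _ _ => by ext; simp
      map_smul' := fun _ _ => by ext; simp }
  have hf : Function.Injective f := by
    rw [← LinearMap.ker_eq_bot, LinearMap.ker_eq_bot']
    intro p hp
    refine Subtype.ext (eq_zero_of_harmonic_of_coeff l p.2.2 fun α hα => ?_)
    by_cases hk : α.degree = k
    · exact congrFun hp ⟨α, hk, hα⟩
    · exact MvPolynomial.IsHomogeneous.coeff_eq_zero p.2.1 hk
  refine (LinearMap.finrank_le_finrank_of_injective hf).trans ?_
  rw [Module.finrank_fintype_fun_eq_card, ← Nat.card_eq_fintype_card]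
  rfl

/-- The monomials left out on the left are exactly `x_l²` times the monomials of degree `k`. -/
theorem ncard_degree_eq_add (d k : ℕ) (l : Fin d) :
    {α : Fin d →₀ ℕ | α.degree = k + 2 ∧ α l ≤ 1}.ncard +
      {α : Fin d →₀ ℕ | α.degree = k}.ncard = {α : Fin d →₀ ℕ | α.degree = k + 2}.ncard := by
  have hinj : Function.Injective fun α : Fin d →₀ ℕ => α + Finsupp.single l 2 :=
    add_left_injective _
  have hf1 : {α : Fin d →₀ ℕ | α.degree = k + 2 ∧ α l ≤ 1}.Finite :=
    (finite_degree_eq d (k + 2)).subset fun α h => h.1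
  rw [← Set.ncard_image_of_injective {α : Fin d →₀ ℕ | α.degree = k} hinj,
    ← Set.ncard_union_eq ?_ hf1 ((finite_degree_eq d k).image _)]
  · congr 1
    ext α
    simp only [mem_union, mem_ofPred_eq, mem_image]
    constructor
    · rintro (h | ⟨β, hβ, rfl⟩)
      · exact h.1
      · simp [hβ]
    · intro h
      by_cases hl : α l ≤ 1
      · exact Or.inl ⟨h, hl⟩
      · have h2 : Finsupp.single l 2 ≤ α := by
          rw [Finsupp.single_le_iff]; omega
        have hα : α - Finsupp.single l 2 + Finsupp.single l 2 = α := tsub_add_cancel_of_le h2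
        refine Or.inr ⟨_, ?_, hα⟩
        have := congrArg Finsupp.degree hα
        simp only [map_add, Finsupp.degree_single] at this
        omega
  · rw [Set.disjoint_left]
    rintro _ ⟨_, h⟩ ⟨β, _, rfl⟩
    simp at h

/-- The lower and upper bounds coincide, so surjectivity of the Laplacian need not be proved
separately. -/
theorem finrank_harmonicPoly_add (d k : ℕ) (hd : 0 < d) :
    Module.finrank ℝ (harmonicPoly d (k + 2)) + (d + k - 1).choose k =
      (d + k + 1).choose (k + 2) := by
  have h1 := finrank_homogeneous_le d k
  have h2 := finrank_harmonicPoly_le d (k + 2) ⟨0, hd⟩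
  have h3 := ncard_degree_eq_add d k ⟨0, hd⟩
  rw [finrank_homogeneousSubmodule, finrank_homogeneousSubmodule] at h1
  rw [ncard_degree_eq, ncard_degree_eq] at h3
  have : d + (k + 2) - 1 = d + k + 1 := by omega
  rw [this] at h1 h3
  omega

theorem finrank_harmonicPoly_one (d : ℕ) : Module.finrank ℝ (harmonicPoly d 1) = d := by
  have : harmonicPoly d 1 = MvPolynomial.homogeneousSubmodule (Fin d) ℝ 1 := by
    refine le_antisymm inf_le_left (le_inf le_rfl fun p hp => ?_)
    rw [LinearMap.mem_ker, polyLaplacian_apply]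
    refine Finset.sum_eq_zero fun i _ => ?_
    have h0 : (MvPolynomial.pderiv i p).IsHomogeneous 0 :=
      MvPolynomial.IsHomogeneous.pderiv (n := 1) hp
    rw [← MvPolynomial.totalDegree_zero_iff_isHomogeneous,
      MvPolynomial.totalDegree_eq_zero_iff_eq_C] at h0
    rw [h0, MvPolynomial.pderiv_C]
  rw [this, finrank_homogeneousSubmodule]
  simp

theorem finrank_harmonicPoly_mul (n k : ℕ) :
    Module.finrank ℝ (harmonicPoly (n + 2) (k + 1)) * ((k + 1)! * n !) =
      (2 * (k + 1) + n) * (k + n)! := by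
  cases k with
  | zero =>
    rw [finrank_harmonicPoly_one]
    simp only [zero_add, Nat.factorial_one]
    ring
  | succ k =>
    have h := finrank_harmonicPoly_add (n + 2) k (by omega)
    have e1 : n + 2 + k - 1 = k + (n + 1) := by omega
    have e2 : n + 2 + k + 1 = (k + 2) + (n + 1) := by omega
    rw [e1, e2] at h
    set F := Module.finrank ℝ (harmonicPoly (n + 2) (k + 1 + 1))
    have h1 := Nat.add_choose_mul_factorial_mul_factorial k (n + 1)
    have h2 := Nat.add_choose_mul_factorial_mul_factorial (k + 2) (n + 1)
    rw [← Nat.choose_symm_add] at h1 h2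
    have e3 : k + (n + 1) = k + n + 1 := by omega
    have e4 : k + 2 + (n + 1) = k + n + 3 := by omega
    have e5 : k + 1 + n = k + n + 1 := by omega
    have e6 : k + 1 + 1 = k + 2 := by omega
    rw [e3] at h h1
    rw [e4] at h h2
    rw [e5, e6]
    -- The factor `n + 1` turns `n !` into the `(n + 1)!` of the two binomial identities.
    refine Nat.eq_of_mul_eq_mul_right (Nat.succ_pos n) ?_
    simp only [Nat.factorial_succ] at *
    have h' : (F : ℤ) = ((k + n + 3).choose (k + 2) : ℤ) - ((k + n + 1).choose k : ℤ) := by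
      rw [← h]; push_cast; ring
    zify at h1 h2 ⊢
    rw [h']
    linear_combination h2 - (k + 2) * (k + 1) * h1

/-! ### Linear isometries acting on polynomials -/

theorem eval_aeval {ι κ : Type*} (g : ι → MvPolynomial κ ℝ) (x : κ → ℝ) (p : MvPolynomial ι ℝ) :
    MvPolynomial.eval x (MvPolynomial.aeval g p) =
      MvPolynomial.eval (fun i => MvPolynomial.eval x (g i)) p := by
  induction p using MvPolynomial.induction_on with
  | C a => simp
  | add p q hp hq => rw [map_add, map_add, hp, hq, map_add]
  | mul_X p i hp => rw [map_mul, map_mul, hp, map_mul, MvPolynomial.aeval_X, MvPolynomial.eval_X]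

/-- Composition of a polynomial with a linear isometry. -/
def compIsometry {d : ℕ} (A : E d ≃ₗᵢ[ℝ] E d) :
    MvPolynomial (Fin d) ℝ →ₐ[ℝ] MvPolynomial (Fin d) ℝ :=
  MvPolynomial.aeval fun i =>
    ∑ j, MvPolynomial.C (A (EuclideanSpace.single j 1) i) * MvPolynomial.X j

theorem isometry_apply_eq_sum {d : ℕ} (A : E d ≃ₗᵢ[ℝ] E d) (x : E d) (i : Fin d) :
    A x i = ∑ j, A (EuclideanSpace.single j 1) i * x j := by
  have hx : x = ∑ j, x j • EuclideanSpace.single j (1 : ℝ) := by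
    ext i
    simp [Finset.sum_apply, Pi.single_apply]
  conv_lhs => rw [hx]
  simp [Finset.sum_apply, mul_comm]

theorem eval_compIsometry {d : ℕ} (A : E d ≃ₗᵢ[ℝ] E d) (p : MvPolynomial (Fin d) ℝ) (x : E d) :
    MvPolynomial.eval x (compIsometry A p) = MvPolynomial.eval (A x) p := by
  rw [compIsometry, eval_aeval]
  congr 2
  ext i
  simp [isometry_apply_eq_sum A x i]

/-- The chain rule for a linear substitution, proved by induction on the polynomial. -/
theorem pderiv_compIsometry {d : ℕ} (A : E d ≃ₗᵢ[ℝ] E d) (p : MvPolynomial (Fin d) ℝ)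
    (j : Fin d) :
    MvPolynomial.pderiv j (compIsometry A p) =
      ∑ i, MvPolynomial.C (A (EuclideanSpace.single j 1) i) *
        compIsometry A (MvPolynomial.pderiv i p) := by
  induction p using MvPolynomial.induction_on with
  | C a => simp [compIsometry]
  | add p q hp hq => simp [hp, hq, mul_add, Finset.sum_add_distrib]
  | mul_X p i hp =>
    have h1 : MvPolynomial.pderiv j (compIsometry A (MvPolynomial.X i)) =
        MvPolynomial.C (A (EuclideanSpace.single j 1) i) := by
      simp [compIsometry, MvPolynomial.pderiv_X, Pi.single_apply]
    have h2 : ∀ b, compIsometry A (MvPolynomial.pderiv b (p * MvPolynomial.X i)) =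
        compIsometry A (MvPolynomial.pderiv b p) * compIsometry A (MvPolynomial.X i) +
          if b = i then compIsometry A p else 0 := by
      intro b
      rw [MvPolynomial.pderiv_mul, MvPolynomial.pderiv_X, map_add, map_mul, map_mul]
      congr 1
      by_cases hb : b = i
      · subst hb; simp
      · simp [hb, Ne.symm hb]
    rw [map_mul, MvPolynomial.pderiv_mul, hp, h1, Finset.sum_mul]
    simp only [h2, mul_add, Finset.sum_add_distrib]
    refine congrArg₂ (· + ·) (Finset.sum_congr rfl fun _ _ => mul_assoc _ _ _) ?_
    simp only [mul_ite, mul_zero, Finset.sum_ite_eq', Finset.mem_univ, if_true]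
    exact mul_comm _ _

/-- The rows of the matrix of `A` are the columns of its transpose `A.symm`, which are orthonormal.
-/
theorem sum_isometry_mul {d : ℕ} (A : E d ≃ₗᵢ[ℝ] E d) (i i' : Fin d) :
    ∑ j, A (EuclideanSpace.single j 1) i * A (EuclideanSpace.single j 1) i' =
      if i = i' then 1 else 0 := by
  have h : ∀ i j, A (EuclideanSpace.single j 1) i = A.symm (EuclideanSpace.single i 1) j := by
    intro i j
    have := A.inner_map_eq_flip (EuclideanSpace.single j 1) (EuclideanSpace.single i 1)
    simpa [EuclideanSpace.inner_single_right, EuclideanSpace.inner_single_left] using this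
  have h2 := A.symm.inner_map_map (EuclideanSpace.single i' 1) (EuclideanSpace.single i 1)
  rw [PiLp.inner_apply, EuclideanSpace.inner_single_left] at h2
  simp only [h]
  simpa [PiLp.single_apply, eq_comm] using h2

theorem polyLaplacian_compIsometry {d : ℕ} (A : E d ≃ₗᵢ[ℝ] E d) (p : MvPolynomial (Fin d) ℝ) :
    polyLaplacian d (compIsometry A p) = compIsometry A (polyLaplacian d p) := by
  simp only [polyLaplacian_apply, pderiv_compIsometry, map_sum, MvPolynomial.pderiv_C_mul,
    Finset.mul_sum]
  rw [Finset.sum_comm]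
  refine Finset.sum_congr rfl fun i _ => ?_
  rw [Finset.sum_comm]
  have : ∀ i', ∑ j, MvPolynomial.C (A (EuclideanSpace.single j 1) i) *
      (MvPolynomial.C (A (EuclideanSpace.single j 1) i') *
        compIsometry A (MvPolynomial.pderiv i' (MvPolynomial.pderiv i p))) =
      if i = i' then compIsometry A (MvPolynomial.pderiv i' (MvPolynomial.pderiv i p)) else 0 := by
    intro i'
    simp only [← mul_assoc, ← Finset.sum_mul, ← map_mul, ← map_sum, sum_isometry_mul]
    split_ifs <;> simp
  rw [Finset.sum_congr rfl fun i' _ => this i']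
  simp

theorem compIsometry_mem {d k : ℕ} (A : E d ≃ₗᵢ[ℝ] E d) {p : MvPolynomial (Fin d) ℝ}
    (hp : p ∈ harmonicPoly d k) : compIsometry A p ∈ harmonicPoly d k := by
  refine ⟨?_, ?_⟩
  · have h1 : p.IsHomogeneous k := hp.1
    have := h1.aeval (S := ℝ) (n := 1) (fun i =>
      ∑ j, MvPolynomial.C (A (EuclideanSpace.single j 1) i) * MvPolynomial.X j) fun i =>
      MvPolynomial.IsHomogeneous.sum _ _ _ fun j _ => MvPolynomial.isHomogeneous_C_mul_X _ _
    rwa [one_mul] at this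
  · have h2 : polyLaplacian d p = 0 := hp.2
    change polyLaplacian d (compIsometry A p) = 0
    rw [polyLaplacian_compIsometry, h2, map_zero]

theorem ext_eval {d : ℕ} {p q : MvPolynomial (Fin d) ℝ}
    (h : ∀ x : E d, MvPolynomial.eval x p = MvPolynomial.eval x q) : p = q :=
  MvPolynomial.funext fun x => h (WithLp.toLp 2 x)

theorem eval_smul_of_isHomogeneous {d k : ℕ} {p : MvPolynomial (Fin d) ℝ}
    (hp : p.IsHomogeneous k) (c : ℝ) (x : E d) :
    MvPolynomial.eval (c • x : E d) p = c ^ k * MvPolynomial.eval x p := by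
  rw [MvPolynomial.eval_eq, MvPolynomial.eval_eq, Finset.mul_sum]
  refine Finset.sum_congr rfl fun α hα => ?_
  have hk : ∑ i ∈ α.support, α i = k := by
    have := hp.degree_eq_sum_deg_support hα
    exact this.symm
  have : ∏ i ∈ α.support, (c • x : E d) i ^ α i = c ^ k * ∏ i ∈ α.support, x i ^ α i := by
    simp only [PiLp.smul_apply, smul_eq_mul, mul_pow, Finset.prod_mul_distrib,
      Finset.prod_pow_eq_pow_sum, hk]
  rw [this]
  ring

theorem exists_eq_norm_smul {d : ℕ} (u : E d) (hu : ‖u‖ = 1) (x : E d) :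
    ∃ y : E d, ‖y‖ = 1 ∧ x = ‖x‖ • y := by
  by_cases hx : x = 0
  · exact ⟨u, hu, by simp [hx]⟩
  · refine ⟨‖x‖⁻¹ • x, by simp [norm_smul, hx], ?_⟩
    rw [smul_smul, mul_inv_cancel₀ (norm_ne_zero_iff.2 hx), one_smul]

/-- A homogeneous polynomial that vanishes on the sphere is zero. -/
theorem eq_zero_of_eval_sphere {d k : ℕ} (hd : 0 < d) {p : MvPolynomial (Fin d) ℝ}
    (hp : p.IsHomogeneous k) (h : ∀ x : S d, MvPolynomial.eval (x : E d) p = 0) : p = 0 := by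
  refine ext_eval fun x => ?_
  obtain ⟨y, hy, hxy⟩ := exists_eq_norm_smul (EuclideanSpace.single ⟨0, hd⟩ 1) (by simp) x
  rw [hxy, eval_smul_of_isHomogeneous hp, h ⟨y, by simpa using hy⟩]
  simp

/-- Homogeneity makes restriction to the sphere injective, so the dimension can be computed on
polynomials. -/
theorem N_eq_finrank {d k : ℕ} (hd : 0 < d) :
    N d k = Module.finrank ℝ (harmonicPoly d k) := by
  let f : harmonicPoly d k →ₗ[ℝ] (S d → ℝ) := (restrictSphere d).domRestrict (harmonicPoly d k)
  have hf : Function.Injective f := by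
    rw [← LinearMap.ker_eq_bot, LinearMap.ker_eq_bot']
    intro p hp
    exact Subtype.ext (eq_zero_of_eval_sphere hd p.2.1 fun x => congrFun hp x)
  have : sphericalHarmonics d k = LinearMap.range f := by
    rw [LinearMap.range_domRestrict]; rfl
  rw [N, this]
  exact LinearMap.finrank_range_of_inj hf

/-! ### Zonal harmonics form a line -/

theorem eLast_eq_single (n : ℕ) :
    eLast (n + 2) = EuclideanSpace.single (Fin.last (n + 1)) 1 := by
  ext i
  simp [eLast, Fin.ext_iff]

theorem norm_eLast (n : ℕ) : ‖eLast (n + 2)‖ = 1 := by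
  simp [eLast_eq_single]

theorem eFirst_eq_single (n : ℕ) : eFirst (n + 2) = EuclideanSpace.single 0 1 := by
  ext i
  simp [eFirst]

theorem exists_isometry_map_eq {d : ℕ} {x y : E d} (h : ‖x‖ = ‖y‖) :
    ∃ A : E d ≃ₗᵢ[ℝ] E d, A x = y :=
  ⟨(ℝ ∙ (x - y))ᗮ.reflection, Submodule.reflection_sub h⟩

/-- The reflection exchanging `x` and `y` fixes everything orthogonal to `x - y`, in particular `e`.
-/
theorem exists_isometry_fix_map_eq {d : ℕ} {e x y : E d} (h : ‖x‖ = ‖y‖) (hx : ⟪x, e⟫ = 0)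
    (hy : ⟪y, e⟫ = 0) : ∃ A : E d ≃ₗᵢ[ℝ] E d, A e = e ∧ A x = y := by
  refine ⟨(ℝ ∙ (x - y))ᗮ.reflection, ?_, Submodule.reflection_sub h⟩
  rw [Submodule.reflection_eq_self_iff, Submodule.mem_orthogonal_singleton_iff_inner_right,
    inner_sub_left, hx, hy, sub_zero]

/-- Substituting `0` for `x_l` keeps exactly the coefficients with `α l = 0`, and here produces the
zero polynomial. -/
theorem coeff_eq_zero_of_eval_hyperplane {d : ℕ} (l : Fin d) {p : MvPolynomial (Fin d) ℝ}
    (h : ∀ x : E d, x l = 0 → MvPolynomial.eval x p = 0) (α : Fin d →₀ ℕ) (hα : α l = 0) :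
    MvPolynomial.coeff α p = 0 := by
  have hr : ∀ q : MvPolynomial (Fin d) ℝ, MvPolynomial.coeff α
      (MvPolynomial.aeval (fun i => if i = l then (0 : MvPolynomial (Fin d) ℝ)
        else MvPolynomial.X i) q) = MvPolynomial.coeff α q := by
    intro q
    induction q using MvPolynomial.induction_on' with
    | monomial β a =>
      rw [MvPolynomial.aeval_monomial]
      by_cases hβ : β l = 0
      · have : (β.prod fun i n => (if i = l then (0 : MvPolynomial (Fin d) ℝ)
            else MvPolynomial.X i) ^ n) = β.prod fun i n => MvPolynomial.X i ^ n := by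
          refine Finsupp.prod_congr fun i hi => ?_
          rw [if_neg]
          rintro rfl
          exact Finsupp.mem_support_iff.1 hi hβ
        rw [this, MvPolynomial.monomial_eq]
        rfl
      · have : (β.prod fun i n => (if i = l then (0 : MvPolynomial (Fin d) ℝ)
            else MvPolynomial.X i) ^ n) = 0 := by
          refine Finset.prod_eq_zero (Finsupp.mem_support_iff.2 hβ) ?_
          simp [hβ]
        rw [this, mul_zero, MvPolynomial.coeff_zero, MvPolynomial.coeff_monomial, if_neg]
        rintro rfl
        exact hβ hα
    | add p q hp hq => simp only [map_add, MvPolynomial.coeff_add, hp, hq]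
  rw [← hr p]
  have h0 : MvPolynomial.aeval (fun i => if i = l then (0 : MvPolynomial (Fin d) ℝ)
        else MvPolynomial.X i) p = 0 := by
    refine ext_eval fun x => ?_
    rw [map_zero, eval_aeval, ← h (WithLp.toLp 2 fun i => if i = l then 0 else x i) (by simp)]
    congr 1
    congr 1
    ext i
    by_cases hi : i = l <;> simp [hi]
  rw [h0, MvPolynomial.coeff_zero]

/-- Harmonic polynomials invariant under the stabilizer of `e`. -/
def IsZonal {d : ℕ} (e : E d) (p : MvPolynomial (Fin d) ℝ) : Prop :=
  ∀ A : E d ≃ₗᵢ[ℝ] E d, A e = e → ∀ x : E d,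
    MvPolynomial.eval (A x) p = MvPolynomial.eval x p

/-- The stabilizer of `e` is transitive on the spheres of `eᗮ`, so one value there determines all
the others by homogeneity. -/
theorem eval_eq_zero_of_inner_eq_zero {d k : ℕ} {e u : E d} {p : MvPolynomial (Fin d) ℝ}
    (hp : p.IsHomogeneous k) (hz : IsZonal e p) (hu : ‖u‖ = 1) (hue : ⟪u, e⟫ = 0)
    (h0 : MvPolynomial.eval u p = 0) (x : E d) (hx : ⟪x, e⟫ = 0) : MvPolynomial.eval x p = 0 := by
  by_cases hx0 : x = 0
  · subst hx0
    have := eval_smul_of_isHomogeneous hp 0 u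
    rwa [zero_smul, h0, mul_zero] at this
  obtain ⟨A, hAe, hA⟩ := exists_isometry_fix_map_eq (e := e) (x := ‖x‖ • u) (y := x)
    (by simp [norm_smul, hu]) (by rw [inner_smul_left, hue, mul_zero]) hx
  rw [← hA, hz A hAe, eval_smul_of_isHomogeneous hp, h0, mul_zero]

/-- Cauchy data on a hyperplane: the values of `p` control the coefficients with `α l = 0`, those of
the normal derivative the ones with `α l = 1`. -/
theorem eq_zero_of_vanishing_hyperplane {d : ℕ} (l : Fin d) {p : MvPolynomial (Fin d) ℝ}
    (hp : polyLaplacian d p = 0) (h0 : ∀ x : E d, x l = 0 → MvPolynomial.eval x p = 0)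
    (h1 : ∀ x : E d, x l = 0 → MvPolynomial.eval x (MvPolynomial.pderiv l p) = 0) : p = 0 := by
  refine eq_zero_of_harmonic_of_coeff l hp fun α hα => ?_
  by_cases hα0 : α l = 0
  · exact coeff_eq_zero_of_eval_hyperplane l h0 α hα0
  · have hα1 : Finsupp.single l 1 ≤ α := by
      rw [Finsupp.single_le_iff]; omega
    have hc := coeff_eq_zero_of_eval_hyperplane l h1 (α - Finsupp.single l 1) (by simp; omega)
    rw [MvPolynomial.coeff_pderiv, tsub_add_cancel_of_le hα1] at hc
    exact (mul_eq_zero.1 hc).resolve_right (by positivity)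

theorem compIsometry_eq_of_isZonal {d : ℕ} {e : E d} {p : MvPolynomial (Fin d) ℝ}
    (hz : IsZonal e p) {A : E d ≃ₗᵢ[ℝ] E d} (hA : A e = e) : compIsometry A p = p :=
  ext_eval fun x => by rw [eval_compIsometry, hz A hA]

theorem isZonal_pderiv {d : ℕ} {l : Fin d} {p : MvPolynomial (Fin d) ℝ}
    (hz : IsZonal (EuclideanSpace.single l 1) p) :
    IsZonal (EuclideanSpace.single l 1) (MvPolynomial.pderiv l p) := by
  intro A hA x
  have h := pderiv_compIsometry A p l
  rw [compIsometry_eq_of_isZonal hz hA, hA, Finset.sum_eq_single l] at h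
  · conv_rhs => rw [h]
    simp [eval_compIsometry]
  · intro b _ hb
    simp [hb]
  · simp

theorem reflection_hyperplane_apply {d : ℕ} (l : Fin d) (x : E d) (hx : x l = 0) :
    (ℝ ∙ (EuclideanSpace.single l 1 : E d))ᗮ.reflection x = x := by
  rw [Submodule.reflection_eq_self_iff, Submodule.mem_orthogonal_singleton_iff_inner_right]
  simp [EuclideanSpace.inner_single_left, hx]

/-- If `R` is the reflection, `-R` fixes the axis; hence `p (R x) = p (-(-R x)) = (-1)^k p x`. -/
theorem compIsometry_reflection_of_isZonal {d k : ℕ} {l : Fin d} {p : MvPolynomial (Fin d) ℝ}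
    (hp : p.IsHomogeneous k) (hz : IsZonal (EuclideanSpace.single l 1) p) :
    compIsometry (ℝ ∙ (EuclideanSpace.single l 1 : E d))ᗮ.reflection p =
      MvPolynomial.C ((-1) ^ k) * p := by
  refine ext_eval fun x => ?_
  set R := (ℝ ∙ (EuclideanSpace.single l 1 : E d))ᗮ.reflection with hR
  have hRe : R (EuclideanSpace.single l 1) = -EuclideanSpace.single l 1 :=
    Submodule.reflection_orthogonalComplement_singleton_eq_neg _
  have h1 := hz (R.trans (LinearIsometryEquiv.neg ℝ)) (by simp [hRe]) x
  have h2 : R x = (-1 : ℝ) • (R.trans (LinearIsometryEquiv.neg ℝ)) x := by simp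
  rw [eval_compIsometry, h2, eval_smul_of_isHomogeneous hp, h1, map_mul, MvPolynomial.eval_C]

/-- One number determines a zonal harmonic. For even `k` parity kills the normal derivative on the
hyperplane and `ψ` is the value at `e_1`; for odd `k` parity kills the values and `ψ` is the normal
derivative at `e_1`. -/
theorem exists_functional_zonal (n k : ℕ) :
    ∃ ψ : MvPolynomial (Fin (n + 2)) ℝ →ₗ[ℝ] ℝ, ∀ p ∈ harmonicPoly (n + 2) k,
      IsZonal (eLast (n + 2)) p → ψ p = 0 → p = 0 := by
  rw [eLast_eq_single]
  set l := Fin.last (n + 1) with hl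
  have hu : ‖(EuclideanSpace.single 0 1 : E (n + 2))‖ = 1 := by simp
  have hue : ⟪(EuclideanSpace.single 0 1 : E (n + 2)), EuclideanSpace.single l 1⟫ = 0 := by
    simp [EuclideanSpace.inner_single_left, hl, Fin.ext_iff]
  have hin : ∀ x : E (n + 2), x l = 0 → ⟪x, EuclideanSpace.single l 1⟫ = 0 := by
    intro x hx
    simp [EuclideanSpace.inner_single_right, hx]
  rcases Nat.even_or_odd k with hk | hk
  · refine ⟨(MvPolynomial.aeval (EuclideanSpace.single 0 1 : E (n + 2)).ofLp).toLinearMap,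
      fun p hp hz h0 => eq_zero_of_vanishing_hyperplane l hp.2 (fun x hx => ?_) fun x hx => ?_⟩
    · exact eval_eq_zero_of_inner_eq_zero hp.1 hz hu hue h0 x (hin x hx)
    · have h := pderiv_compIsometry (ℝ ∙ (EuclideanSpace.single l 1 : E (n + 2)))ᗮ.reflection p l
      rw [compIsometry_reflection_of_isZonal hp.1 hz, hk.neg_one_pow, map_one, one_mul,
        Submodule.reflection_orthogonalComplement_singleton_eq_neg, Finset.sum_eq_single l] at h
      · have h' := congrArg (MvPolynomial.eval x) h
        rw [map_mul, eval_compIsometry, reflection_hyperplane_apply l x hx] at h'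
        simp at h'
        linarith
      · intro b _ hb
        simp [hb]
      · simp
  · refine ⟨(MvPolynomial.aeval (EuclideanSpace.single 0 1 : E (n + 2)).ofLp).toLinearMap ∘ₗ
      (MvPolynomial.pderiv l).toLinearMap,
      fun p hp hz h0 => eq_zero_of_vanishing_hyperplane l hp.2 (fun x hx => ?_) fun x hx => ?_⟩
    · have h := congrArg (MvPolynomial.eval x) (compIsometry_reflection_of_isZonal hp.1 hz)
      rw [eval_compIsometry, reflection_hyperplane_apply l x hx, hk.neg_one_pow] at h
      simp at h
      linarith
    · exact eval_eq_zero_of_inner_eq_zero (MvPolynomial.IsHomogeneous.pderiv hp.1)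
        (isZonal_pderiv hz) hu hue h0 x (hin x hx)

/-- Zonal harmonics of a given degree form a line. -/
theorem eval_smul_eq_of_isZonal {n k : ℕ} {p q : MvPolynomial (Fin (n + 2)) ℝ}
    (hp : p ∈ harmonicPoly (n + 2) k) (hq : q ∈ harmonicPoly (n + 2) k)
    (hzp : IsZonal (eLast (n + 2)) p) (hzq : IsZonal (eLast (n + 2)) q) :
    MvPolynomial.eval (eLast (n + 2)) q • p = MvPolynomial.eval (eLast (n + 2)) p • q := by
  obtain ⟨ψ, hψ⟩ := exists_functional_zonal n k
  -- The difference of the two sides is a zonal harmonic on which `ψ` vanishes.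
  have key : ψ q • p = ψ p • q := by
    rw [← sub_eq_zero]
    refine hψ _ (Submodule.sub_mem _ (Submodule.smul_mem _ _ hp) (Submodule.smul_mem _ _ hq)) ?_ ?_
    · intro A hA x
      simp [hzp A hA, hzq A hA, MvPolynomial.smul_eval]
    · simp [mul_comm]
  have key2 : ψ q * MvPolynomial.eval (eLast (n + 2)) p =
      ψ p * MvPolynomial.eval (eLast (n + 2)) q := by
    have := congrArg (MvPolynomial.eval (eLast (n + 2)).ofLp) key
    simpa [MvPolynomial.smul_eval] using this
  by_cases h : ψ q = 0
  · rw [hψ q hq hzq h]; simp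
  · refine smul_right_injective _ h ?_
    simp only
    rw [smul_comm, key, smul_smul, smul_smul, key2, mul_comm]

/-! ### Rotation invariance of the uniform measure -/

instance (n : ℕ) : IsFiniteMeasure (surf n) := by
  unfold surf; infer_instance

theorem surf_univ_ne_zero (n : ℕ) : surf (n + 2) univ ≠ 0 := by
  rw [Measure.measure_univ_ne_zero]
  exact Measure.toSphere_ne_zero _

theorem surf_univ_ne_top (n : ℕ) : surf n univ ≠ ⊤ := measure_ne_top _ _

theorem area_pos (n : ℕ) : 0 < area (n + 2) :=
  ENNReal.toReal_pos (surf_univ_ne_zero n) (surf_univ_ne_top _)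

instance (n : ℕ) : IsProbabilityMeasure (unif (n + 2)) :=
  ⟨by rw [unif, Measure.smul_apply, smul_eq_mul,
    ENNReal.inv_mul_cancel (surf_univ_ne_zero n) (surf_univ_ne_top _)]⟩

instance (n : ℕ) : (unif (n + 2)).IsOpenPosMeasure := by
  have : (surf (n + 2)).IsOpenPosMeasure := by unfold surf; infer_instance
  refine ⟨fun U hU hne => ?_⟩
  rw [unif, Measure.smul_apply, smul_eq_mul]
  exact mul_ne_zero (ENNReal.inv_ne_zero.2 (surf_univ_ne_top _)) (hU.measure_ne_zero _ hne)

/-- The action of a linear isometry on the sphere. -/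
def sphereMap {d : ℕ} (A : E d ≃ₗᵢ[ℝ] E d) (x : S d) : S d := ⟨A x, by simp⟩

@[simp]
theorem coe_sphereMap {d : ℕ} (A : E d ≃ₗᵢ[ℝ] E d) (x : S d) : (sphereMap A x : E d) = A x := rfl

theorem continuous_sphereMap {d : ℕ} (A : E d ≃ₗᵢ[ℝ] E d) : Continuous (sphereMap A) :=
  Continuous.subtype_mk (A.continuous.comp continuous_subtype_val) _

theorem measurableEmbedding_sphereMap {d : ℕ} (A : E d ≃ₗᵢ[ℝ] E d) :
    MeasurableEmbedding (sphereMap A) :=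
  (continuous_sphereMap A).measurableEmbedding fun _ _ h =>
    Subtype.ext (A.injective (congrArg Subtype.val h))

-- The measure of `s` is a multiple of the volume of the cone `(0,1) • s`, and `A` carries cones to
-- cones while preserving volume.
open scoped Pointwise in
theorem measurePreserving_sphereMap_surf {d : ℕ} (A : E d ≃ₗᵢ[ℝ] E d) :
    MeasurePreserving (sphereMap A) (surf d) (surf d) := by
  refine ⟨(continuous_sphereMap A).measurable, ?_⟩
  ext s hs
  rw [Measure.map_apply (continuous_sphereMap A).measurable hs, surf,
    Measure.toSphere_apply' _ ((continuous_sphereMap A).measurable hs),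
    Measure.toSphere_apply' _ hs]
  congr 1
  have : Ioo (0 : ℝ) 1 • (Subtype.val '' s : Set (E d)) =
      A '' (Ioo (0 : ℝ) 1 • (Subtype.val '' (sphereMap A ⁻¹' s))) := by
    ext x
    simp only [mem_smul, mem_image, mem_preimage]
    constructor
    · rintro ⟨r, hr, _, ⟨y, hy, rfl⟩, rfl⟩
      refine ⟨r • A.symm y, ⟨r, hr, A.symm y, ⟨sphereMap A.symm y, ?_, rfl⟩, rfl⟩, by simp⟩
      have : sphereMap A (sphereMap A.symm y) = y := Subtype.ext (by simp)
      rwa [this]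
    · rintro ⟨_, ⟨r, hr, _, ⟨y, hy, rfl⟩, rfl⟩, rfl⟩
      exact ⟨r, hr, _, ⟨_, hy, rfl⟩, by simp⟩
  rw [this]
  have h := A.measurePreserving.measure_preimage_equiv (f := A.toMeasurableEquiv)
    (A '' (Ioo (0 : ℝ) 1 • (Subtype.val '' (sphereMap A ⁻¹' s))))
  rw [← h]
  congr 1
  exact (preimage_image_eq _ A.injective).symm

theorem measurePreserving_sphereMap {d : ℕ} (A : E d ≃ₗᵢ[ℝ] E d) :
    MeasurePreserving (sphereMap A) (unif d) (unif d) :=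
  (measurePreserving_sphereMap_surf A).smul_measure _

theorem integral_comp_sphereMap {d : ℕ} (A : E d ≃ₗᵢ[ℝ] E d) (f : S d → ℝ) :
    ∫ x, f (sphereMap A x) ∂(unif d) = ∫ x, f x ∂(unif d) :=
  (measurePreserving_sphereMap A).integral_comp (measurableEmbedding_sphereMap A) f

/-! ### The reproducing kernel of the space of harmonics -/

theorem continuous_eval_sphere {d : ℕ} (p : MvPolynomial (Fin d) ℝ) :
    Continuous fun x : S d => MvPolynomial.eval (x : E d) p :=
  (MvPolynomial.continuous_eval p).comp
    ((PiLp.continuous_ofLp 2 _).comp continuous_subtype_val)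

theorem integrable_of_continuous {n : ℕ} {f : S (n + 2) → ℝ} (hf : Continuous f) :
    Integrable f (unif (n + 2)) :=
  hf.integrable_of_hasCompactSupport (HasCompactSupport.of_compactSpace f)

/-- The `L²` inner product of two polynomials on the sphere. -/
def sphereInner (n : ℕ) (p q : MvPolynomial (Fin (n + 2)) ℝ) : ℝ :=
  ∫ x : S (n + 2), MvPolynomial.eval (x : E (n + 2)) p * MvPolynomial.eval (x : E (n + 2)) q
    ∂(unif (n + 2))

theorem integrable_eval_mul {n : ℕ} (p q : MvPolynomial (Fin (n + 2)) ℝ) :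
    Integrable (fun x : S (n + 2) => MvPolynomial.eval (x : E (n + 2)) p *
      MvPolynomial.eval (x : E (n + 2)) q) (unif (n + 2)) :=
  integrable_of_continuous ((continuous_eval_sphere p).mul (continuous_eval_sphere q))

theorem sphereInner_comm {n : ℕ} (p q : MvPolynomial (Fin (n + 2)) ℝ) :
    sphereInner n p q = sphereInner n q p := by
  simp only [sphereInner, mul_comm]

theorem sphereInner_add_left {n : ℕ} (p q r : MvPolynomial (Fin (n + 2)) ℝ) :
    sphereInner n (p + q) r = sphereInner n p r + sphereInner n q r := by
  simp only [sphereInner, map_add, add_mul]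
  exact integral_add (integrable_eval_mul p r) (integrable_eval_mul q r)

theorem sphereInner_smul_left {n : ℕ} (c : ℝ) (p r : MvPolynomial (Fin (n + 2)) ℝ) :
    sphereInner n (c • p) r = c * sphereInner n p r := by
  simp only [sphereInner, MvPolynomial.smul_eval, mul_assoc]
  exact integral_const_mul _ _

theorem sphereInner_self_nonneg {n : ℕ} (p : MvPolynomial (Fin (n + 2)) ℝ) :
    0 ≤ sphereInner n p p :=
  integral_nonneg fun _ => mul_self_nonneg _

theorem eq_zero_of_sphereInner_self {n k : ℕ} {p : MvPolynomial (Fin (n + 2)) ℝ}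
    (hp : p.IsHomogeneous k) (h : sphereInner n p p = 0) : p = 0 := by
  refine eq_zero_of_eval_sphere (by omega) hp fun x => ?_
  have hc := (continuous_eval_sphere p).mul (continuous_eval_sphere p)
  have h0 := (Continuous.integral_pos_of_hasCompactSupport_nonneg_nonzero (μ := unif (n + 2)) hc
    (HasCompactSupport.of_compactSpace _) (fun _ => mul_self_nonneg _) (x := x))
  by_contra hx
  exact (h0 (mul_self_ne_zero.2 hx)).ne' h

theorem sphereInner_compIsometry {n : ℕ} (A : E (n + 2) ≃ₗᵢ[ℝ] E (n + 2))
    (p q : MvPolynomial (Fin (n + 2)) ℝ) :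
    sphereInner n (compIsometry A p) (compIsometry A q) = sphereInner n p q := by
  simp only [sphereInner, eval_compIsometry]
  exact integral_comp_sphereMap A fun x => MvPolynomial.eval (x : E (n + 2)) p *
    MvPolynomial.eval (x : E (n + 2)) q

theorem compIsometry_symm_compIsometry {d : ℕ} (A : E d ≃ₗᵢ[ℝ] E d)
    (p : MvPolynomial (Fin d) ℝ) : compIsometry A.symm (compIsometry A p) = p :=
  ext_eval fun x => by simp [eval_compIsometry]

/-- The inner product on harmonic polynomials given by integration over the sphere. -/
@[reducible] def harmonicInnerCore (n k : ℕ) : InnerProductSpace.Core ℝ (harmonicPoly (n + 2) k) where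
  inner p q := sphereInner n p q
  conj_inner_symm _ _ := sphereInner_comm _ _
  re_inner_nonneg p := sphereInner_self_nonneg p.1
  add_left _ _ _ := sphereInner_add_left _ _ _
  smul_left _ _ _ := sphereInner_smul_left _ _ _
  definite p h := Subtype.ext (eq_zero_of_sphereInner_self p.2.1 h)

/-- States the basis through `sphereInner`, so that the inner product structure stays local to this
proof. -/
theorem exists_orthonormal_harmonics (n k : ℕ) :
    ∃ b : Fin (Module.finrank ℝ (harmonicPoly (n + 2) k)) → harmonicPoly (n + 2) k,
      (∀ i j, sphereInner n (b i) (b j) = if i = j then 1 else 0) ∧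
      ∀ p : harmonicPoly (n + 2) k, p = ∑ i, sphereInner n (b i) p • b i := by
  let _ : NormedAddCommGroup (harmonicPoly (n + 2) k) :=
    (harmonicInnerCore n k).toNormedAddCommGroup
  let _ : InnerProductSpace ℝ (harmonicPoly (n + 2) k) :=
    InnerProductSpace.ofCore (harmonicInnerCore n k).toCore
  let b := stdOrthonormalBasis ℝ (harmonicPoly (n + 2) k)
  refine ⟨b, fun i j => ?_, fun p => ?_⟩
  · exact orthonormal_iff_ite.1 b.orthonormal i j
  · exact (b.sum_repr' p).symm

/-- Riesz representation in finite dimension, with the representer written in an orthonormal basis.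
-/
theorem exists_sphereInner_eq {n k : ℕ} (F : harmonicPoly (n + 2) k →ₗ[ℝ] ℝ) :
    ∃ W ∈ harmonicPoly (n + 2) k, ∀ p : harmonicPoly (n + 2) k, F p = sphereInner n W p := by
  obtain ⟨b, -, hsum⟩ := exists_orthonormal_harmonics n k
  let W : harmonicPoly (n + 2) k := ∑ i, F (b i) • b i
  refine ⟨W, W.2, fun p => ?_⟩
  have h : ∀ s : Finset (Fin (Module.finrank ℝ (harmonicPoly (n + 2) k))),
      sphereInner n (∑ i ∈ s, F (b i) • b i : harmonicPoly (n + 2) k) p =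
        ∑ i ∈ s, F (b i) * sphereInner n (b i) p := by
    intro s
    induction s using Finset.cons_induction with
    | empty => simp [sphereInner]
    | cons i s hi ih =>
      rw [Finset.sum_cons, Finset.sum_cons, ← ih, Submodule.coe_add, sphereInner_add_left,
        Submodule.coe_smul, sphereInner_smul_left]
  rw [h]
  conv_lhs => rw [hsum p]
  simp [mul_comm]

theorem eq_of_sphereInner_eq {n k : ℕ} {p q : MvPolynomial (Fin (n + 2)) ℝ}
    (hp : p ∈ harmonicPoly (n + 2) k) (hq : q ∈ harmonicPoly (n + 2) k)
    (h : ∀ r ∈ harmonicPoly (n + 2) k, sphereInner n p r = sphereInner n q r) : p = q := by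
  have hs := Submodule.sub_mem _ hp hq
  rw [← sub_eq_zero]
  refine eq_zero_of_sphereInner_self hs.1 ?_
  have := h _ hs
  rw [sub_eq_add_neg p q, sphereInner_add_left, ← sub_eq_add_neg, ← neg_one_smul ℝ q,
    sphereInner_smul_left, this]
  ring

/-- A representer of an invariant functional is invariant. -/
theorem isZonal_of_sphereInner_eq {n k : ℕ} {e : E (n + 2)} {W : MvPolynomial (Fin (n + 2)) ℝ}
    (hW : W ∈ harmonicPoly (n + 2) k)
    (h : ∀ A : E (n + 2) ≃ₗᵢ[ℝ] E (n + 2), A e = e → ∀ p ∈ harmonicPoly (n + 2) k,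
      sphereInner n W (compIsometry A p) = sphereInner n W p) : IsZonal e W := by
  intro A hA x
  rw [← eval_compIsometry]
  congr 1
  refine eq_of_sphereInner_eq (compIsometry_mem A hW) hW fun r hr => ?_
  have hs : A.symm e = e := by rw [LinearIsometryEquiv.symm_apply_eq, hA]
  rw [← h A.symm hs r hr, ← sphereInner_compIsometry A W]
  congr 1
  exact (compIsometry_symm_compIsometry A.symm r).symm

/-- The zonal reproducing kernel: it represents the evaluation at `y`. -/
theorem exists_reproducing (n k : ℕ) (y : E (n + 2)) :
    ∃ Z ∈ harmonicPoly (n + 2) k, ∀ p ∈ harmonicPoly (n + 2) k,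
      sphereInner n Z p = MvPolynomial.eval y p := by
  obtain ⟨Z, hZ, h⟩ := exists_sphereInner_eq (n := n) (k := k)
    ((MvPolynomial.aeval y.ofLp).toLinearMap.domRestrict (harmonicPoly (n + 2) k))
  exact ⟨Z, hZ, fun p hp => (h ⟨p, hp⟩).symm⟩

/-- The trace of the kernel: by transitivity of rotations `∑ b_i(y)²` equals `Z(e)` at every `y`,
and its integral is the number of basis vectors. -/
theorem eval_reproducing_self {n k : ℕ} {e : E (n + 2)} (he : ‖e‖ = 1)
    {Z : MvPolynomial (Fin (n + 2)) ℝ}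
    (hZ : Z ∈ harmonicPoly (n + 2) k)
    (h : ∀ p ∈ harmonicPoly (n + 2) k, sphereInner n Z p = MvPolynomial.eval e p) :
    MvPolynomial.eval e Z = N (n + 2) k := by
  obtain ⟨b, hb, hsum⟩ := exists_orthonormal_harmonics n k
  have key : ∀ y : S (n + 2), ∑ i, MvPolynomial.eval (y : E (n + 2)) (b i : MvPolynomial _ ℝ) *
      MvPolynomial.eval (y : E (n + 2)) (b i : MvPolynomial _ ℝ) = MvPolynomial.eval e Z := by
    intro y
    obtain ⟨A, hA⟩ := exists_isometry_map_eq (x := (y : E (n + 2))) (y := e) (by simp [he])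
    have hZA := compIsometry_mem A hZ
    have h1 := hsum ⟨_, hZA⟩
    have h2 := congrArg (fun p : harmonicPoly (n + 2) k => MvPolynomial.eval (y : E (n + 2)) p.1) h1
    simp only [Submodule.coe_sum, map_sum, Submodule.coe_smul, MvPolynomial.smul_eval,
      eval_compIsometry, hA] at h2
    rw [h2]
    refine Finset.sum_congr rfl fun i _ => ?_
    congr 1
    -- The coefficient of `Z ∘ A` along `b i` is `⟨Z, b i ∘ A⁻¹⟩ = b i (A⁻¹ e) = b i y`.
    rw [sphereInner_comm, ← sphereInner_compIsometry A.symm, compIsometry_symm_compIsometry,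
      h _ (compIsometry_mem _ (b i).2), eval_compIsometry, ← hA]
    simp
  have hint : ∫ y : S (n + 2), ∑ i,
      MvPolynomial.eval (y : E (n + 2)) (b i : MvPolynomial _ ℝ) *
      MvPolynomial.eval (y : E (n + 2)) (b i : MvPolynomial _ ℝ) ∂(unif (n + 2)) =
      MvPolynomial.eval e Z := by
    simp only [key]
    simp
  rw [integral_finsetSum _ fun i _ => integrable_eval_mul _ _] at hint
  have : ∀ i, ∫ y : S (n + 2), MvPolynomial.eval (y : E (n + 2)) (b i : MvPolynomial _ ℝ) *
      MvPolynomial.eval (y : E (n + 2)) (b i : MvPolynomial _ ℝ) ∂(unif (n + 2)) = 1 := by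
    intro i
    have := hb i i
    rwa [if_pos rfl] at this
  simp only [this] at hint
  rw [← hint, N_eq_finrank (by omega)]
  simp

section

/-! ### The Legendre harmonic -/

theorem N_mul_factorial (n k : ℕ) :
    N (n + 2) (k + 1) * ((k + 1)! * n !) = (2 * (k + 1) + n) * (k + n)! := by
  rw [N_eq_finrank (by omega), finrank_harmonicPoly_mul]

/-- Since `(k+1)! n! ≤ (k+n+1)!` and `2(k+1) + n > k+n+1`, the value `N ≤ 1` is impossible. -/
theorem two_le_N (n k : ℕ) : 2 ≤ N (n + 2) (k + 1) := by
  have h := N_mul_factorial n k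
  have h1 : (k + 1)! * n ! ≤ (k + 1 + n)! :=
    Nat.le_of_dvd (Nat.factorial_pos _) (Nat.factorial_mul_factorial_dvd_factorial_add _ _)
  rw [show k + 1 + n = k + n + 1 by omega, Nat.factorial_succ (k + n)] at h1
  have h2 : 0 < (k + n)! := Nat.factorial_pos _
  by_contra! hN
  have h3 : N (n + 2) (k + 1) * ((k + 1)! * n !) ≤ 1 * ((k + 1)! * n !) :=
    Nat.mul_le_mul_right _ (by omega)
  nlinarith

theorem N_formula {d k : ℕ} (hd : 2 ≤ d) (hk : 1 ≤ k) :
    (N d k : ℝ) =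
      (2 * (k : ℝ) + (d : ℝ) - 2) * ((k + d - 3)! : ℝ) / ((k ! : ℝ) * ((d - 2)! : ℝ)) := by
  obtain ⟨n, rfl⟩ := Nat.exists_eq_add_of_le' hd
  obtain ⟨j, rfl⟩ := Nat.exists_eq_add_of_le' hk
  rw [eq_div_iff (by positivity)]
  have h := N_mul_factorial n j
  rw [show j + 1 + (n + 2) - 3 = j + n by omega, Nat.add_sub_cancel]
  have h' := congrArg (Nat.cast (R := ℝ)) h
  push_cast at h' ⊢
  linear_combination h'

variable {n k : ℕ}

theorem exists_zonal_reproducing (n k : ℕ) :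
    ∃ Z ∈ harmonicPoly (n + 2) k, IsZonal (eLast (n + 2)) Z ∧
      (∀ p ∈ harmonicPoly (n + 2) k, sphereInner n Z p = MvPolynomial.eval (eLast (n + 2)) p) ∧
      MvPolynomial.eval (eLast (n + 2)) Z = N (n + 2) k := by
  obtain ⟨Z, hZ, h⟩ := exists_reproducing n k (eLast (n + 2))
  refine ⟨Z, hZ, isZonal_of_sphereInner_eq hZ fun A hA p hp => ?_, h,
    eval_reproducing_self (norm_eLast n) hZ h⟩
  rw [h _ (compIsometry_mem A hp), h _ hp, eval_compIsometry, hA]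

/-- Existence is the kernel at the pole divided by `N`; uniqueness is the line property. -/
theorem existsUnique_isLegendreHarmonic (n k : ℕ) :
    ∃! p : MvPolynomial (Fin (n + 2)) ℝ, IsLegendreHarmonic (n + 2) (k + 1) p := by
  obtain ⟨Z, hZ, hz, -, hN⟩ := exists_zonal_reproducing n (k + 1)
  have hN0 : (N (n + 2) (k + 1) : ℝ) ≠ 0 := by
    have := two_le_N n k
    positivity
  refine ⟨(N (n + 2) (k + 1) : ℝ)⁻¹ • Z, ⟨Submodule.smul_mem _ _ hZ, fun A hA x => ?_, ?_⟩, ?_⟩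
  · simp [MvPolynomial.smul_eval, hz A hA]
  · rw [MvPolynomial.smul_eval, hN, inv_mul_cancel₀ hN0]
  · intro q hq
    have := eval_smul_eq_of_isZonal hZ hq.mem hz hq.invariant
    rw [hq.normalized, hN, one_smul] at this
    rw [this, smul_smul, inv_mul_cancel₀ hN0, one_smul]

theorem isLegendreHarmonic (n k : ℕ) :
    IsLegendreHarmonic (n + 2) (k + 1) (legendreHarmonic (n + 2) (k + 1)) :=
  Classical.epsilon_spec (existsUnique_isLegendreHarmonic n k).exists

/-- The reproducing kernel at the pole is `N L`. -/
theorem sphereInner_legendreHarmonic (n k : ℕ) {p : MvPolynomial (Fin (n + 2)) ℝ}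
    (hp : p ∈ harmonicPoly (n + 2) (k + 1)) :
    N (n + 2) (k + 1) * sphereInner n (legendreHarmonic (n + 2) (k + 1)) p =
      MvPolynomial.eval (eLast (n + 2)) p := by
  obtain ⟨Z, hZ, hz, hr, hN⟩ := exists_zonal_reproducing n (k + 1)
  have hL := isLegendreHarmonic n k
  have := eval_smul_eq_of_isZonal hZ hL.mem hz hL.invariant
  rw [hL.normalized, hN, one_smul] at this
  rw [← hr p hp, this, sphereInner_smul_left]

theorem continuous_L (d k : ℕ) : Continuous (L d k) := continuous_eval_sphere _

/-- The reproducing identity applied to `L` itself; this is where the factor `√N` originates. -/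
theorem integral_L_sq (n k : ℕ) :
    N (n + 2) (k + 1) * ∫ x, L (n + 2) (k + 1) x ^ 2 ∂(unif (n + 2)) = 1 := by
  have h := sphereInner_legendreHarmonic n k (isLegendreHarmonic n k).mem
  rw [(isLegendreHarmonic n k).normalized] at h
  simpa only [sphereInner, L, sq] using h

/-- Cauchy–Schwarz: if `A e_d = x`, then `L x = N ⟨L, L ∘ A⟩` with `‖L‖² = ‖L ∘ A‖² = 1 / N`. It is
read off from `‖L ± L ∘ A‖² ≥ 0`. -/
theorem abs_L_le_one (n k : ℕ) (x : S (n + 2)) : |L (n + 2) (k + 1) x| ≤ 1 := by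
  obtain ⟨A, hA⟩ := exists_isometry_map_eq (x := eLast (n + 2)) (y := (x : E (n + 2)))
    (by simp [norm_eLast])
  set p := legendreHarmonic (n + 2) (k + 1) with hp
  have hL := isLegendreHarmonic n k
  have h1 := sphereInner_legendreHarmonic n k (compIsometry_mem A hL.mem)
  rw [eval_compIsometry, hA] at h1
  have h2 : N (n + 2) (k + 1) * sphereInner n p p = 1 := by
    rw [sphereInner_legendreHarmonic n k hL.mem, hL.normalized]
  have h3 := sphereInner_compIsometry A p p
  have hexp : ∀ c : ℝ, sphereInner n (p + c • compIsometry A p) (p + c • compIsometry A p) =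
      sphereInner n p p + 2 * c * sphereInner n p (compIsometry A p) +
        c ^ 2 * sphereInner n p p := by
    intro c
    rw [sphereInner_add_left, sphereInner_comm, sphereInner_add_left, sphereInner_smul_left,
      sphereInner_smul_left, sphereInner_comm (compIsometry A p) (p + _), sphereInner_add_left,
      sphereInner_smul_left, h3, sphereInner_comm (compIsometry A p) p]
    ring
  have hm := hexp (-1)
  have hp1 := hexp 1
  have hm0 := sphereInner_self_nonneg (p + (-1 : ℝ) • compIsometry A p)
  have hp0 := sphereInner_self_nonneg (p + (1 : ℝ) • compIsometry A p)
  have hN : (0 : ℝ) ≤ N (n + 2) (k + 1) := by positivity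
  have hLx : L (n + 2) (k + 1) x = N (n + 2) (k + 1) * sphereInner n p (compIsometry A p) :=
    h1.symm
  rw [hLx, abs_le]
  constructor <;> nlinarith

/-! ### The Funk–Hecke formula -/

/-- The representer of an invariant functional is zonal, hence a multiple of `L`, which represents
evaluation at `e_d` up to the factor `N`. -/
theorem functional_eq_mul_eval_eLast (F : MvPolynomial (Fin (n + 2)) ℝ →ₗ[ℝ] ℝ)
    (hF : ∀ A : E (n + 2) ≃ₗᵢ[ℝ] E (n + 2), A (eLast (n + 2)) = eLast (n + 2) →
      ∀ p, F (compIsometry A p) = F p)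
    {p : MvPolynomial (Fin (n + 2)) ℝ} (hp : p ∈ harmonicPoly (n + 2) (k + 1)) :
    F p = F (legendreHarmonic (n + 2) (k + 1)) * MvPolynomial.eval (eLast (n + 2)) p := by
  obtain ⟨W, hW, h⟩ := exists_sphereInner_eq (n := n) (k := k + 1) (F.domRestrict _)
  have h' : ∀ p ∈ harmonicPoly (n + 2) (k + 1), F p = sphereInner n W p :=
    fun p hp => h ⟨p, hp⟩
  have hL := isLegendreHarmonic n k
  have hz : IsZonal (eLast (n + 2)) W := isZonal_of_sphereInner_eq hW fun A hA p hp => by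
    rw [← h' p hp, ← h' _ (compIsometry_mem A hp), hF A hA]
  have hWL := eval_smul_eq_of_isZonal hW hL.mem hz hL.invariant
  rw [hL.normalized, one_smul] at hWL
  have hN := integral_L_sq n k
  have hLL : sphereInner n (legendreHarmonic (n + 2) (k + 1)) (legendreHarmonic (n + 2) (k + 1)) =
      ∫ x, L (n + 2) (k + 1) x ^ 2 ∂(unif (n + 2)) := by
    simp only [sphereInner, L, sq]
  rw [h' p hp, h' _ hL.mem, hWL, sphereInner_smul_left, sphereInner_smul_left, hLL,
    ← sphereInner_legendreHarmonic n k hp]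
  linear_combination (-MvPolynomial.eval (eLast (n + 2)) W *
    sphereInner n (legendreHarmonic (n + 2) (k + 1)) p) * hN

theorem inner_mem_Icc (x y : S (n + 2)) : ⟪(x : E (n + 2)), (y : E (n + 2))⟫ ∈ Icc (-1 : ℝ) 1 := by
  have := abs_real_inner_le_norm (x : E (n + 2)) (y : E (n + 2))
  simp only [norm_eq_of_mem_sphere, mul_one] at this
  exact abs_le.1 this

theorem measurable_inner_sphere (σ : ℝ → ℝ) (hσ : Measurable σ) (d : ℕ) :
    Measurable fun z : S d × S d => σ ⟪(z.1 : E d), (z.2 : E d)⟫ := by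
  refine hσ.comp ?_
  fun_prop

/-- The north pole, as a point of the sphere. -/
def pole (n : ℕ) : S (n + 2) := ⟨eLast (n + 2), by simp [norm_eLast]⟩

/-- The Funk–Hecke eigenvalue. -/
def eigenvalue (n k : ℕ) (σ : ℝ → ℝ) : ℝ :=
  ∫ x, σ ⟪(pole n : E (n + 2)), (x : E (n + 2))⟫ * L (n + 2) (k + 1) x ∂(unif (n + 2))

theorem integrable_of_bounded {f : S (n + 2) → ℝ} (μ : Measure (S (n + 2))) [IsFiniteMeasure μ]
    (hf : Measurable f) {M : ℝ} (hM : ∀ x, |f x| ≤ M) : Integrable f μ :=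
  Integrable.of_bound hf.aestronglyMeasurable M (Filter.Eventually.of_forall hM)

theorem exists_bound {σ : ℝ → ℝ} (hσ : IsBoundedActivation σ) :
    ∃ M : ℝ, 0 ≤ M ∧ ∀ x y : S (n + 2), |σ ⟪(x : E (n + 2)), (y : E (n + 2))⟫| ≤ M := by
  obtain ⟨M, hM⟩ := hσ.bounded
  exact ⟨M, (abs_nonneg _).trans (hM 0 (by simp)), fun x y => hM _ (inner_mem_Icc x y)⟩

theorem integrable_activation {σ : ℝ → ℝ} (hσ : IsBoundedActivation σ) (μ : Measure (S (n + 2)))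
    [IsFiniteMeasure μ] (x : S (n + 2)) :
    Integrable (fun y : S (n + 2) => σ ⟪(x : E (n + 2)), (y : E (n + 2))⟫) μ := by
  obtain ⟨M, -, hM⟩ := exists_bound (n := n) hσ
  exact integrable_of_bounded μ
    ((measurable_inner_sphere σ hσ.measurable (n + 2)).comp measurable_prodMk_left) (hM x)

theorem integrable_activation_mul_eval {σ : ℝ → ℝ} (hσ : IsBoundedActivation σ) (x : S (n + 2))
    (p : MvPolynomial (Fin (n + 2)) ℝ) :
    Integrable (fun y : S (n + 2) => σ ⟪(x : E (n + 2)), (y : E (n + 2))⟫ *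
      MvPolynomial.eval (y : E (n + 2)) p) (unif (n + 2)) := by
  obtain ⟨M, -, hM⟩ := exists_bound (n := n) hσ
  exact (integrable_of_continuous (continuous_eval_sphere p)).bdd_mul
    (integrable_activation hσ _ x).aestronglyMeasurable (Filter.Eventually.of_forall (hM x))

/-- The functional `p ↦ ∫ σ(⟨θ, x⟩) p(x) dτ(x)`. -/
def convFunctional {σ : ℝ → ℝ} (hσ : IsBoundedActivation σ) (θ : S (n + 2)) :
    MvPolynomial (Fin (n + 2)) ℝ →ₗ[ℝ] ℝ where
  toFun p := ∫ x : S (n + 2), σ ⟪(θ : E (n + 2)), (x : E (n + 2))⟫ *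
    MvPolynomial.eval (x : E (n + 2)) p ∂(unif (n + 2))
  map_add' p q := by
    simp only [map_add, mul_add]
    exact integral_add (integrable_activation_mul_eval hσ θ p)
      (integrable_activation_mul_eval hσ θ q)
  map_smul' c p := by
    simp only [MvPolynomial.smul_eval, mul_left_comm _ c, RingHom.id_apply, smul_eq_mul]
    exact integral_const_mul _ _

theorem convFunctional_compIsometry {σ : ℝ → ℝ} (hσ : IsBoundedActivation σ) (θ : S (n + 2))
    (A : E (n + 2) ≃ₗᵢ[ℝ] E (n + 2)) (p : MvPolynomial (Fin (n + 2)) ℝ) :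
    convFunctional hσ θ (compIsometry A p) = convFunctional hσ (sphereMap A θ) p := by
  have h := integral_comp_sphereMap A fun x : S (n + 2) =>
    σ ⟪(sphereMap A θ : E (n + 2)), (x : E (n + 2))⟫ * MvPolynomial.eval (x : E (n + 2)) p
  simp only [coe_sphereMap, LinearIsometryEquiv.inner_map_map, ← eval_compIsometry] at h
  exact h

/-- Rotate the pole to `θ`. The functional at the pole is invariant under the stabilizer, so on `L ∘
A` it is the eigenvalue times `L (A e_d) = L θ`. -/
theorem integral_activation_mul_L {σ : ℝ → ℝ} (hσ : IsBoundedActivation σ) (k : ℕ)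
    (θ : S (n + 2)) :
    ∫ x, σ ⟪(θ : E (n + 2)), (x : E (n + 2))⟫ * L (n + 2) (k + 1) x ∂(unif (n + 2)) =
      eigenvalue n k σ * L (n + 2) (k + 1) θ := by
  obtain ⟨A, hA⟩ := exists_isometry_map_eq (x := eLast (n + 2)) (y := (θ : E (n + 2)))
    (by simp [norm_eLast])
  have hθ : sphereMap A (pole n) = θ := Subtype.ext hA
  have hL := isLegendreHarmonic n k
  change convFunctional hσ θ (legendreHarmonic (n + 2) (k + 1)) = _
  rw [← hθ, ← convFunctional_compIsometry,
    functional_eq_mul_eval_eLast (k := k) _ _ (compIsometry_mem A hL.mem), eval_compIsometry]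
  · rfl
  · intro B hB p
    have : sphereMap B (pole n) = pole n := Subtype.ext hB
    rw [convFunctional_compIsometry, this]

/-- Funk–Hecke with `σ = 1` gives `c = c L(θ)` for the mean `c`; if `c ≠ 0` then `L ≡ 1`, so `N =
1`. -/
theorem integral_L (n k : ℕ) : ∫ x, L (n + 2) (k + 1) x ∂(unif (n + 2)) = 0 := by
  have hσ : IsBoundedActivation fun _ => 1 := ⟨measurable_const, 1, fun _ _ => by simp⟩
  have h := integral_activation_mul_L (n := n) hσ k
  simp only [one_mul] at h
  by_contra hne
  have hp := h (pole n)
  have hL1 : L (n + 2) (k + 1) (pole n) = 1 := (isLegendreHarmonic n k).normalized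
  rw [hL1, mul_one] at hp
  have hconst : ∀ x, L (n + 2) (k + 1) x = 1 := fun x =>
    mul_left_cancel₀ hne (by rw [mul_one]; conv_rhs => rw [h x, ← hp])
  have hsq := integral_L_sq n k
  simp only [hconst] at hsq
  have h2 := two_le_N n k
  have : (2 : ℝ) ≤ N (n + 2) (k + 1) := by exact_mod_cast h2
  simp at hsq
  linarith

theorem integral_abs_L_pos (n k : ℕ) : 0 < ∫ x, |L (n + 2) (k + 1) x| ∂(unif (n + 2)) := by
  refine Continuous.integral_pos_of_hasCompactSupport_nonneg_nonzero (continuous_L _ _).abs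
    (HasCompactSupport.of_compactSpace _) (fun _ => abs_nonneg _) (x := pole n) ?_
  have hL1 : L (n + 2) (k + 1) (pole n) = 1 := (isLegendreHarmonic n k).normalized
  simp [hL1]

end

section

/-! ### Integration of functions of the last coordinate -/

open scoped ENNReal

theorem lintegral_polar (m : ℕ) (g : E (m + 1) → ℝ≥0∞) :
    ∫⁻ y, g y = ∫⁻ z : S (m + 1) × Ioi (0 : ℝ), g ((z.2 : ℝ) • (z.1 : E (m + 1)))
      ∂((surf (m + 1)).prod (Measure.volumeIoiPow m)) := by
  have h := (volume : Measure (E (m + 1))).measurePreserving_homeomorphUnitSphereProd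
  have hdim : Module.finrank ℝ (E (m + 1)) - 1 = m := by simp
  rw [hdim] at h
  have h1 : ∫⁻ y, g y = ∫⁻ y : ({0}ᶜ : Set (E (m + 1))), g y ∂(Measure.comap Subtype.val volume) := by
    rw [lintegral_subtype_comap (measurableSet_singleton _).compl, Measure.restrict_eq_self_of_ae_mem]
    exact compl_mem_ae_iff.2 (measure_singleton 0)
  rw [h1, surf, ← h.lintegral_comp_emb (homeomorphUnitSphereProd _).measurableEmbedding]
  refine lintegral_congr fun y => ?_
  rw [← homeomorphUnitSphereProd_symm_apply_coe, Homeomorph.symm_apply_apply]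

theorem lintegral_volumeIoiPow (m : ℕ) {g : ℝ → ℝ≥0∞} (hg : Measurable g) :
    ∫⁻ r : Ioi (0 : ℝ), g r ∂(Measure.volumeIoiPow m) =
      ∫⁻ r in Ioi (0 : ℝ), ENNReal.ofReal (r ^ m) * g r := by
  rw [Measure.volumeIoiPow, lintegral_withDensity_eq_lintegral_mul _ (by fun_prop)
    (g := fun r : Ioi (0 : ℝ) => g r) (hg.comp measurable_subtype_coe)]
  exact lintegral_subtype_comap measurableSet_Ioi fun r => ENNReal.ofReal (r ^ m) * g r

theorem lintegral_radial (m : ℕ) {g : ℝ → ℝ≥0∞} (hg : Measurable g) :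
    ∫⁻ y : E (m + 1), g ‖y‖ =
      surf (m + 1) univ * ∫⁻ r in Ioi (0 : ℝ), ENNReal.ofReal (r ^ m) * g r := by
  rw [lintegral_polar m fun y => g ‖y‖,
    ← lintegral_volumeIoiPow m hg]
  have : ∀ z : S (m + 1) × Ioi (0 : ℝ), g ‖(z.2 : ℝ) • (z.1 : E (m + 1))‖ = 1 * g z.2 := by
    intro z
    have hz : (0 : ℝ) < z.2 := z.2.2
    simp [norm_smul, abs_of_pos hz]
  simp only [this]
  rw [lintegral_prod_mul (g := fun r : Ioi (0 : ℝ) => g r) aemeasurable_const (hg.comp measurable_subtype_coe).aemeasurable]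
  simp

theorem lintegral_split_last (m : ℕ) {F : ℝ → ℝ → ℝ≥0∞} (hF : Measurable (Function.uncurry F)) :
    ∫⁻ y : E (m + 1), F (y (Fin.last m)) ‖y‖ =
      ∫⁻ t : ℝ, ∫⁻ z : E m, F t (√(t ^ 2 + ‖z‖ ^ 2)) := by
  have h1 := PiLp.volume_preserving_ofLp (Fin (m + 1))
  have h2 := volume_preserving_piFinSuccAbove (fun _ : Fin (m + 1) => ℝ) (Fin.last m)
  have h3 := (MeasurePreserving.id (volume : Measure ℝ)).prod (PiLp.volume_preserving_toLp (Fin m))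
  have h := (h3.comp h2).comp h1
  have hm : Measurable fun p : ℝ × E m => F p.1 (√(p.1 ^ 2 + ‖p.2‖ ^ 2)) :=
    hF.comp (f := fun p : ℝ × E m => (p.1, √(p.1 ^ 2 + ‖p.2‖ ^ 2))) (by fun_prop)
  rw [← lintegral_prod (fun p : ℝ × E m => F p.1 (√(p.1 ^ 2 + ‖p.2‖ ^ 2))) hm.aemeasurable,
    ← h.lintegral_comp hm]
  refine lintegral_congr fun y => ?_
  simp only [Function.comp, MeasurableEquiv.piFinSuccAbove_apply, Fin.insertNthEquiv_symm_apply,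
    Prod.map, id]
  congr 1
  rw [EuclideanSpace.norm_eq, EuclideanSpace.norm_sq_eq, Fin.sum_univ_succAbove _ (Fin.last m)]
  simp [Fin.removeNth]

/-- The substitution `t = cos s`; for dimension `n + 2` the weight exponent `(d-3)/2` is `(n-1)/2`,
and the Jacobian completes it to `sin^n`. -/
theorem lintegral_cos (n : ℕ) (f : ℝ → ℝ≥0∞) :
    ∫⁻ t in Ioo (-1 : ℝ) 1, f t * ENNReal.ofReal ((1 - t ^ 2) ^ (((n : ℝ) - 1) / 2)) =
      ∫⁻ s in Ioo 0 Real.pi, ENNReal.ofReal (Real.sin s ^ n) * f (Real.cos s) := by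
  have himg : Real.cos '' Ioo 0 Real.pi = Ioo (-1) 1 := by
    exact Real.cosPartialHomeomorph.image_source_eq_target
  rw [← himg, lintegral_image_eq_lintegral_abs_deriv_mul measurableSet_Ioo
    (fun s _ => (Real.hasDerivAt_cos s).hasDerivWithinAt)
    (Real.injOn_cos.mono Ioo_subset_Icc_self)]
  refine setLIntegral_congr_fun measurableSet_Ioo fun s hs => ?_
  have hs0 : 0 < Real.sin s := Real.sin_pos_of_mem_Ioo hs
  have h1 : 1 - Real.cos s ^ 2 = Real.sin s ^ (2 : ℝ) := by
    rw [← Real.sin_sq]; norm_cast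
  have h2 : Real.sin s * (1 - Real.cos s ^ 2) ^ (((n : ℝ) - 1) / 2) = Real.sin s ^ n := by
    rw [h1, ← Real.rpow_mul hs0.le, show (2 : ℝ) * (((n : ℝ) - 1) / 2) = n - 1 by ring,
      Real.rpow_sub_one hs0.ne', mul_div_cancel₀ _ hs0.ne', Real.rpow_natCast]
  simp only [abs_neg, abs_of_pos hs0]
  rw [mul_left_comm, ← ENNReal.ofReal_mul hs0.le, h2, mul_comm]

/-- Planar polar coordinates `t = ρ cos s`, `r = ρ sin s`: the Jacobian `ρ` and `r^n` combine to
`ρ^(n+1) sin^n s`. -/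
theorem lintegral_half_plane (n : ℕ) {f w : ℝ → ℝ≥0∞} (hf : Measurable f) (hw : Measurable w) :
    ∫⁻ t : ℝ, ∫⁻ r in Ioi (0 : ℝ), ENNReal.ofReal (r ^ n) *
        (f (t / √(t ^ 2 + r ^ 2)) * w (√(t ^ 2 + r ^ 2))) =
      (∫⁻ s in Ioo 0 Real.pi, ENNReal.ofReal (Real.sin s ^ n) * f (Real.cos s)) *
        ∫⁻ ρ in Ioi (0 : ℝ), ENNReal.ofReal (ρ ^ (n + 1)) * w ρ := by
  let H : ℝ × ℝ → ℝ≥0∞ := fun p => (Ioi (0 : ℝ)).indicator (fun r => ENNReal.ofReal (r ^ n) *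
        (f (p.1 / √(p.1 ^ 2 + r ^ 2)) * w (√(p.1 ^ 2 + r ^ 2)))) p.2
  have hH : Measurable H := by
    have : H = (univ ×ˢ Ioi (0 : ℝ)).indicator (fun p : ℝ × ℝ => ENNReal.ofReal (p.2 ^ n) *
        (f (p.1 / √(p.1 ^ 2 + p.2 ^ 2)) * w (√(p.1 ^ 2 + p.2 ^ 2)))) := by
      ext p
      by_cases hp : 0 < p.2 <;> simp [H, hp]
    rw [this]
    refine Measurable.indicator ?_ (MeasurableSet.univ.prod measurableSet_Ioi)
    refine Measurable.mul (by fun_prop) (Measurable.mul (hf.comp ?_) (hw.comp ?_)) <;> fun_prop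
  have h1 : ∫⁻ t : ℝ, ∫⁻ r in Ioi (0 : ℝ), ENNReal.ofReal (r ^ n) *
        (f (t / √(t ^ 2 + r ^ 2)) * w (√(t ^ 2 + r ^ 2))) = ∫⁻ p, H p := by
    rw [Measure.volume_eq_prod, lintegral_prod _ hH.aemeasurable]
    refine lintegral_congr fun t => ?_
    rw [← lintegral_indicator measurableSet_Ioi]
  have hf' : Measurable fun s => ENNReal.ofReal (Real.sin s ^ n) * f (Real.cos s) :=
    Measurable.mul (by fun_prop) (hf.comp (by fun_prop))
  have hw' : Measurable fun ρ : ℝ => ENNReal.ofReal (ρ ^ (n + 1)) * w ρ := by fun_prop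
  rw [h1, ← lintegral_comp_polarCoord_symm, mul_comm,
    ← lintegral_prod_mul hw'.aemeasurable hf'.aemeasurable,
    Measure.prod_restrict, ← Measure.volume_eq_prod, polarCoord_target,
    ← lintegral_indicator (measurableSet_Ioi.prod measurableSet_Ioo),
    ← lintegral_indicator (measurableSet_Ioi.prod measurableSet_Ioo)]
  refine lintegral_congr fun ⟨ρ, s⟩ => ?_
  by_cases hρ : 0 < ρ
  swap
  · simp [hρ]
  by_cases hs : s ∈ Ioo 0 Real.pi
  · have hs0 : 0 < Real.sin s := Real.sin_pos_of_mem_Ioo hs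
    have hs' : s ∈ Ioo (-Real.pi) Real.pi := ⟨by linarith [hs.1, Real.pi_pos], hs.2⟩
    have hnorm : √((ρ * Real.cos s) ^ 2 + (ρ * Real.sin s) ^ 2) = ρ := by
      rw [show (ρ * Real.cos s) ^ 2 + (ρ * Real.sin s) ^ 2 =
        ρ ^ 2 * (Real.sin s ^ 2 + Real.cos s ^ 2) by ring, Real.sin_sq_add_cos_sq, mul_one,
        Real.sqrt_sq hρ.le]
    rw [indicator_of_mem (by exact ⟨hρ, hs'⟩), indicator_of_mem (by exact ⟨hρ, hs⟩)]
    simp only [H, polarCoord_symm_apply]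
    rw [indicator_of_mem (by exact mul_pos hρ hs0), hnorm, mul_div_cancel_left₀ _ hρ.ne',
      smul_eq_mul, mul_pow, pow_succ, ENNReal.ofReal_mul (by positivity),
      ENNReal.ofReal_mul (by positivity)]
    ring
  · rw [indicator_of_notMem (s := Ioi 0 ×ˢ Ioo 0 Real.pi) (by exact fun h => hs h.2)]
    -- Angles `s ≤ 0` give `r ≤ 0`, outside the half-plane, so `H` vanishes there.
    by_cases hs' : s ∈ Ioo (-Real.pi) Real.pi
    · rw [indicator_of_mem (by exact ⟨hρ, hs'⟩)]
      have hs0 : s ≤ 0 := by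
        by_contra! h
        exact hs ⟨h, hs'.2⟩
      have hsin : Real.sin s ≤ 0 := Real.sin_nonpos_of_nonpos_of_neg_pi_le hs0 hs'.1.le
      simp only [H, polarCoord_symm_apply]
      rw [indicator_of_notMem, smul_zero]
      exact not_lt.2 (mul_nonpos_of_nonneg_of_nonpos hρ.le hsin)
    · rw [indicator_of_notMem (by exact fun h => hs' h.2)]

/-- Integrate `f (y_last / ‖y‖) w ‖y‖` over the whole space in two ways: polar coordinates directly,
or splitting off the last coordinate and using polar coordinates in the remaining ones. The same
radial factor `K` appears in both and cancels. -/
theorem lintegral_last_coordinate (n : ℕ) {f : ℝ → ℝ≥0∞} (hf : Measurable f) :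
    ∫⁻ x : S (n + 2), f ((x : E (n + 2)) (Fin.last (n + 1))) ∂(surf (n + 2)) =
      surf (n + 1) univ * ∫⁻ t in Ioo (-1 : ℝ) 1, f t *
        ENNReal.ofReal ((1 - t ^ 2) ^ (((n : ℝ) - 1) / 2)) := by
  -- The cutoff to the unit ball only serves to make `K` finite and nonzero.
  set w : ℝ → ℝ≥0∞ := (Iio 1).indicator 1 with hw_def
  have hw : Measurable w := measurable_one.indicator measurableSet_Iio
  set K := ∫⁻ ρ in Ioi (0 : ℝ), ENNReal.ofReal (ρ ^ (n + 1)) * w ρ with hK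
  have hKval : K = Measure.volumeIoiPow (n + 1) (Iio ⟨1, mem_Ioi.2 one_pos⟩) := by
    rw [hK, ← lintegral_volumeIoiPow _ hw, ← lintegral_indicator_one measurableSet_Iio]
    refine lintegral_congr fun r => ?_
    by_cases hr : (r : ℝ) < 1
    · have : r ∈ Iio (⟨1, mem_Ioi.2 one_pos⟩ : Ioi (0 : ℝ)) := hr
      rw [indicator_of_mem this, hw_def, indicator_of_mem (by exact hr)]
      rfl
    · have : r ∉ Iio (⟨1, mem_Ioi.2 one_pos⟩ : Ioi (0 : ℝ)) := hr
      rw [indicator_of_notMem this, hw_def, indicator_of_notMem (by exact hr)]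
  rw [Measure.volumeIoiPow_apply_Iio] at hKval
  have hK0 : K ≠ 0 := by
    rw [hKval]
    exact (ENNReal.ofReal_pos.2 (by positivity)).ne'
  have hKtop : K ≠ ⊤ := by
    rw [hKval]
    exact ENNReal.ofReal_ne_top
  have hmF : Measurable (Function.uncurry fun t r : ℝ => f (t / r) * w r) := by
    refine Measurable.mul (hf.comp ?_) (hw.comp ?_) <;> fun_prop
  have hleft : ∫⁻ y : E (n + 2), f (y (Fin.last (n + 1)) / ‖y‖) * w ‖y‖ =
      (∫⁻ x : S (n + 2), f ((x : E (n + 2)) (Fin.last (n + 1))) ∂(surf (n + 2))) * K := by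
    rw [lintegral_polar (n + 1) fun y => f (y (Fin.last (n + 1)) / ‖y‖) * w ‖y‖,
      hK, ← lintegral_volumeIoiPow _ hw,
      ← lintegral_prod_mul (f := fun x : S (n + 2) => f ((x : E (n + 2)) (Fin.last (n + 1))))
        (g := fun r : Ioi (0 : ℝ) => w r) (hf.comp (by fun_prop)).aemeasurable (hw.comp measurable_subtype_coe).aemeasurable]
    refine lintegral_congr fun z => ?_
    have hz : (0 : ℝ) < z.2 := z.2.2
    simp [norm_smul, abs_of_pos hz, hz.ne']
  have hright : ∫⁻ y : E (n + 2), f (y (Fin.last (n + 1)) / ‖y‖) * w ‖y‖ =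
      (surf (n + 1) univ * ∫⁻ t in Ioo (-1 : ℝ) 1, f t *
        ENNReal.ofReal ((1 - t ^ 2) ^ (((n : ℝ) - 1) / 2))) * K := by
    rw [lintegral_split_last (n + 1) (F := fun t r => f (t / r) * w r) hmF, lintegral_cos, mul_assoc,
      ← lintegral_half_plane n hf hw, ← lintegral_const_mul' _ _ (surf_univ_ne_top _)]
    refine lintegral_congr fun t => ?_
    exact lintegral_radial n (g := fun r => f (t / √(t ^ 2 + r ^ 2)) * w (√(t ^ 2 + r ^ 2)))
      (hmF.comp (f := fun r : ℝ => (t, √(t ^ 2 + r ^ 2))) (by fun_prop))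
  exact (ENNReal.mul_left_inj hK0 hKtop).1 (hleft.symm.trans hright)

/-- Proved as an equality of measures, so integrability of `g` plays no role. Only the sign of `c`
matters, because `c` cancels in the distance formula. -/
theorem exists_integral_last_coordinate (n : ℕ) :
    ∃ c : ℝ, 0 < c ∧ ∀ g : ℝ → ℝ, Measurable g →
      ∫ x : S (n + 2), g ((x : E (n + 2)) (Fin.last (n + 1))) ∂(unif (n + 2)) =
        c * weightedIntegral (n + 2) g := by
  have hc : 0 < surf (n + 1) univ := by
    rw [pos_iff_ne_zero, Measure.measure_univ_ne_zero]
    exact Measure.toSphere_ne_zero _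
  have hc' : 0 < (surf (n + 1)).real univ := ENNReal.toReal_pos hc.ne' (surf_univ_ne_top _)
  have hlast : Measurable fun x : S (n + 2) => (x : E (n + 2)) (Fin.last (n + 1)) := by fun_prop
  set ω : ℝ → ℝ := fun t => (1 - t ^ 2) ^ (((n : ℝ) - 1) / 2) with hω
  have hωm : Measurable ω := by fun_prop
  have hmap : (surf (n + 2)).map (fun x : S (n + 2) => (x : E (n + 2)) (Fin.last (n + 1))) =
      surf (n + 1) univ • ((volume.restrict (Ioo (-1 : ℝ) 1)).withDensity
        fun t => ENNReal.ofReal (ω t)) := by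
    refine Measure.ext_of_lintegral _ fun f hf => ?_
    rw [lintegral_map hf hlast, lintegral_last_coordinate n hf, lintegral_smul_measure,
      lintegral_withDensity_eq_lintegral_mul _ (by fun_prop) hf, smul_eq_mul]
    simp only [Pi.mul_apply, mul_comm (f _), hω]
  refine ⟨(surf (n + 2) univ)⁻¹.toReal * (surf (n + 1)).real univ, ?_, fun g hg => ?_⟩
  · refine mul_pos (ENNReal.toReal_pos ?_ ?_) hc'
    · exact ENNReal.inv_ne_zero.2 (surf_univ_ne_top _)
    · exact ENNReal.inv_ne_top.2 (surf_univ_ne_zero n)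
  · rw [unif, integral_smul_measure, smul_eq_mul, mul_assoc]
    congr 1
    rw [← integral_map hlast.aemeasurable hg.aestronglyMeasurable, hmap, integral_smul_measure,
      smul_eq_mul, Measure.real]
    congr 1
    rw [weightedIntegral, intervalIntegral.integral_of_le (by norm_num), integral_Ioc_eq_integral_Ioo,
      integral_withDensity_eq_integral_toReal_smul (by fun_prop)
        (Filter.Eventually.of_forall fun _ => ENNReal.ofReal_lt_top)]
    refine setIntegral_congr_fun measurableSet_Ioo fun t ht => ?_
    have h1 : 0 ≤ 1 - t ^ 2 := by nlinarith [ht.1, ht.2]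
    have h2 : (((n + 2 : ℕ) : ℝ) - 3) / 2 = ((n : ℝ) - 1) / 2 := by push_cast; ring
    simp only [h2, hω]
    rw [ENNReal.toReal_ofReal (Real.rpow_nonneg h1 _), smul_eq_mul, mul_comm]

/-! ### Integrals against the Legendre harmonic as weighted integrals -/

theorem L_eq_P {n k : ℕ} (x : S (n + 2)) :
    L (n + 2) (k + 1) x = P (n + 2) (k + 1) ((x : E (n + 2)) (Fin.last (n + 1))) := by
  set l := Fin.last (n + 1) with hl
  set t := (x : E (n + 2)) l with ht
  have hL := isLegendreHarmonic n k
  have hte : ⟪(x : E (n + 2)), eLast (n + 2)⟫ = t := by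
    rw [eLast_eq_single]; simp [EuclideanSpace.inner_single_right, ht, hl]
  have hee : ⟪eLast (n + 2), eLast (n + 2)⟫ = (1 : ℝ) := by
    rw [real_inner_self_eq_norm_sq, norm_eLast, one_pow]
  have hfe : ⟪eFirst (n + 2), eLast (n + 2)⟫ = (0 : ℝ) := by
    rw [eLast_eq_single, eFirst_eq_single]
    simp [EuclideanSpace.inner_single_left, Fin.ext_iff]
  have hf1 : ‖eFirst (n + 2)‖ = 1 := by rw [eFirst_eq_single]; simp
  set v : E (n + 2) := (x : E (n + 2)) - t • eLast (n + 2) with hv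
  have hve : ⟪v, eLast (n + 2)⟫ = (0 : ℝ) := by
    rw [hv, inner_sub_left, hte, real_inner_smul_left, hee, mul_one, sub_self]
  have hvn : ‖v‖ ^ 2 = 1 - t ^ 2 := by
    rw [hv, norm_sub_sq_real, norm_eq_of_mem_sphere, real_inner_smul_right, hte, norm_smul,
      norm_eLast, Real.norm_eq_abs, mul_one, sq_abs]
    ring
  have hvs : ‖v‖ = √(1 - t ^ 2) := by rw [← hvn, Real.sqrt_sq (norm_nonneg _)]
  obtain ⟨ξ, hξ, hξe, hvξ⟩ : ∃ ξ : E (n + 2), ‖ξ‖ = 1 ∧ ⟪ξ, eLast (n + 2)⟫ = (0 : ℝ) ∧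
      v = ‖v‖ • ξ := by
    -- At the two poles `√(1 - t²) = 0`, so any admissible `ξ` will do.
    by_cases h0 : v = 0
    · exact ⟨eFirst (n + 2), hf1, hfe, by simp [h0]⟩
    · have h0' := norm_ne_zero_iff.2 h0
      refine ⟨‖v‖⁻¹ • v, by simp [norm_smul, h0], ?_, ?_⟩
      · rw [real_inner_smul_left, hve, mul_zero]
      · rw [smul_smul, mul_inv_cancel₀ h0', one_smul]
  have hx : (x : E (n + 2)) = t • eLast (n + 2) + √(1 - t ^ 2) • ξ := by
    rw [← hvs, ← hvξ, hv]; abel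
  rw [L, P]
  conv_lhs => rw [hx]
  exact eval_slice_eq hL hξ hf1 hξe hfe t

theorem measurable_P (d k : ℕ) : Measurable (P d k) := by
  refine Continuous.measurable ((MvPolynomial.continuous_eval _).comp
    ((PiLp.continuous_ofLp 2 _).comp ?_))
  fun_prop

theorem inner_pole (n : ℕ) (x : S (n + 2)) :
    ⟪(pole n : E (n + 2)), (x : E (n + 2))⟫ = (x : E (n + 2)) (Fin.last (n + 1)) := by
  change ⟪eLast (n + 2), (x : E (n + 2))⟫ = _
  rw [eLast_eq_single]
  simp [EuclideanSpace.inner_single_left]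

theorem exists_eigenvalue_eq (n k : ℕ) :
    ∃ c : ℝ, 0 < c ∧
      (∀ σ : ℝ → ℝ, Measurable σ → eigenvalue n k σ =
        c * weightedIntegral (n + 2) fun t => P (n + 2) (k + 1) t * σ t) ∧
      ∫ x, |L (n + 2) (k + 1) x| ∂(unif (n + 2)) =
        c * weightedIntegral (n + 2) fun t => |P (n + 2) (k + 1) t| := by
  obtain ⟨c, hc, h⟩ := exists_integral_last_coordinate n
  refine ⟨c, hc, fun σ hσ => ?_, ?_⟩
  · rw [← h (fun t => P (n + 2) (k + 1) t * σ t) ((measurable_P _ _).mul hσ)]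
    simp only [eigenvalue, inner_pole, L_eq_P, mul_comm]
  · rw [← h _ (measurable_P _ _).abs]
    simp only [L_eq_P]

end

section

/-! ### The pair of measures -/

theorem integral_surf (n : ℕ) (g : S (n + 2) → ℝ) :
    ∫ x, g x ∂(surf (n + 2)) = area (n + 2) * ∫ x, g x ∂(unif (n + 2)) := by
  rw [unif, integral_smul_measure, smul_eq_mul, ENNReal.toReal_inv, ← mul_assoc]
  have : area (n + 2) * ((surf (n + 2)) univ).toReal⁻¹ = 1 := mul_inv_cancel₀ (area_pos n).ne'
  rw [this, one_mul]

theorem gammaConst_pos (n k : ℕ) : 0 < gammaConst (n + 2) (k + 1) :=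
  mul_pos two_pos (inv_pos.2 (integral_abs_L_pos n k))

/-- The density of `μ_d` (`s = 1`) and `ν_d` (`s = -1`). -/
def signedDensity (n k : ℕ) (s : ℝ) (x : S (n + 2)) : ℝ :=
  gammaConst (n + 2) (k + 1) * max (s * L (n + 2) (k + 1) x) 0 / area (n + 2)

theorem continuous_signedDensity (n k : ℕ) (s : ℝ) : Continuous (signedDensity n k s) := by
  have := continuous_L (n + 2) (k + 1)
  unfold signedDensity
  fun_prop

theorem signedDensity_nonneg (n k : ℕ) (s : ℝ) (x : S (n + 2)) : 0 ≤ signedDensity n k s x :=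
  div_nonneg (mul_nonneg (gammaConst_pos n k).le (le_max_right _ _)) (area_pos n).le

theorem signedDensity_sub (n k : ℕ) (x : S (n + 2)) :
    signedDensity n k 1 x - signedDensity n k (-1) x =
      gammaConst (n + 2) (k + 1) * L (n + 2) (k + 1) x / area (n + 2) := by
  have : max (1 * L (n + 2) (k + 1) x) 0 - max (-1 * L (n + 2) (k + 1) x) 0 =
      L (n + 2) (k + 1) x := by
    rcases le_total 0 (L (n + 2) (k + 1) x) with h | h
    · rw [max_eq_left (by linarith), max_eq_right (by linarith)]; ring
    · rw [max_eq_right (by linarith), max_eq_left (by linarith)]; ring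
  rw [signedDensity, signedDensity, ← sub_div, ← mul_sub, this]

theorem muMeas_eq (n k : ℕ) : muMeas (n + 2) (k + 1) =
    (surf (n + 2)).withDensity fun x => ENNReal.ofReal (signedDensity n k 1 x) := by
  refine withDensity_congr_ae (Filter.Eventually.of_forall fun x => ?_)
  simp only [signedDensity, one_mul]
  split_ifs with h
  · rw [max_eq_left h.le]
  · rw [max_eq_right (not_lt.1 h)]; simp

theorem nuMeas_eq (n k : ℕ) : nuMeas (n + 2) (k + 1) =
    (surf (n + 2)).withDensity fun x => ENNReal.ofReal (signedDensity n k (-1) x) := by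
  refine withDensity_congr_ae (Filter.Eventually.of_forall fun x => ?_)
  simp only [signedDensity, neg_mul, one_mul]
  split_ifs with h
  · rw [max_eq_right (by linarith)]; simp
  · rw [max_eq_left (by linarith [not_lt.1 h]), mul_neg]

/-- Since `max (s L) 0 = (|L| + s L) / 2` and `L` has mean zero, each sign carries half of `γ ∫ |L|
= 2`. -/
theorem isProbabilityMeasure_withDensity_signedDensity (n k : ℕ) {s : ℝ} (hs : |s| = 1) :
    IsProbabilityMeasure
      ((surf (n + 2)).withDensity fun x => ENNReal.ofReal (signedDensity n k s x)) := by
  refine ⟨?_⟩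
  have hint : Integrable (signedDensity n k s) (surf (n + 2)) :=
    (continuous_signedDensity n k s).integrable_of_hasCompactSupport
      (HasCompactSupport.of_compactSpace _)
  rw [withDensity_apply _ MeasurableSet.univ, Measure.restrict_univ,
    ← ofReal_integral_eq_lintegral_ofReal hint
      (Filter.Eventually.of_forall (signedDensity_nonneg n k s)), integral_surf]
  have hL := continuous_L (n + 2) (k + 1)
  have h1 : ∀ x, signedDensity n k s x = gammaConst (n + 2) (k + 1) / (2 * area (n + 2)) *
      (|L (n + 2) (k + 1) x| + s * L (n + 2) (k + 1) x) := by
    intro x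
    have hmax : max (s * L (n + 2) (k + 1) x) 0 =
        (|L (n + 2) (k + 1) x| + s * L (n + 2) (k + 1) x) / 2 := by
      have habs : |L (n + 2) (k + 1) x| = |s * L (n + 2) (k + 1) x| := by
        rw [abs_mul, hs, one_mul]
      rw [habs]
      rcases le_total 0 (s * L (n + 2) (k + 1) x) with h | h
      · rw [max_eq_left h, abs_of_nonneg h]; ring
      · rw [max_eq_right h, abs_of_nonpos h]; ring
    rw [signedDensity, hmax]
    ring
  simp only [h1]
  rw [integral_const_mul, integral_add (integrable_of_continuous hL.abs)
    (integrable_of_continuous (hL.const_mul s)), integral_const_mul, integral_L, gammaConst]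
  have h2 := (integral_abs_L_pos n k).ne'
  have h3 := (area_pos n).ne'
  rw [show area (n + 2) * (2 * (∫ x, |L (n + 2) (k + 1) x| ∂(unif (n + 2)))⁻¹ /
    (2 * area (n + 2)) * (∫ x, |L (n + 2) (k + 1) x| ∂(unif (n + 2)) + s * 0)) = 1 by
      field_simp; simp]
  simp

theorem isProbabilityMeasure_muMeas (n k : ℕ) :
    IsProbabilityMeasure (muMeas (n + 2) (k + 1)) := by
  rw [muMeas_eq]
  exact isProbabilityMeasure_withDensity_signedDensity n k (by simp)

theorem isProbabilityMeasure_nuMeas (n k : ℕ) :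
    IsProbabilityMeasure (nuMeas (n + 2) (k + 1)) := by
  rw [nuMeas_eq]
  exact isProbabilityMeasure_withDensity_signedDensity n k (by simp)

variable {n k : ℕ}

theorem integral_mu_sub_integral_nu {f : S (n + 2) → ℝ} (hf : Measurable f) {M : ℝ}
    (hM : ∀ x, |f x| ≤ M) :
    (∫ x, f x ∂(muMeas (n + 2) (k + 1))) - ∫ x, f x ∂(nuMeas (n + 2) (k + 1)) =
      gammaConst (n + 2) (k + 1) * ∫ x, f x * L (n + 2) (k + 1) x ∂(unif (n + 2)) := by
  have h : ∀ s, ∫ x, f x ∂((surf (n + 2)).withDensity fun x =>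
      ENNReal.ofReal (signedDensity n k s x)) =
      ∫ x, signedDensity n k s x * f x ∂(surf (n + 2)) := by
    intro s
    rw [integral_withDensity_eq_integral_toReal_smul
      (continuous_signedDensity n k s).measurable.ennreal_ofReal
        (Filter.Eventually.of_forall fun _ => ENNReal.ofReal_lt_top)]
    simp only [ENNReal.toReal_ofReal (signedDensity_nonneg n k s _), smul_eq_mul]
  have hi : ∀ s, Integrable (fun x => signedDensity n k s x * f x) (surf (n + 2)) := by
    intro s
    exact ((continuous_signedDensity n k s).integrable_of_hasCompactSupport
      (HasCompactSupport.of_compactSpace _)).mul_bdd hf.aestronglyMeasurable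
        (Filter.Eventually.of_forall hM)
  rw [muMeas_eq, nuMeas_eq, h, h, ← integral_sub (hi 1) (hi (-1)), integral_surf]
  simp only [← sub_mul, signedDensity_sub]
  rw [← integral_const_mul, ← integral_const_mul]
  refine integral_congr_ae (Filter.Eventually.of_forall fun x => ?_)
  have := (area_pos n).ne'
  simp only
  field_simp

/-! ### The integral probability metrics -/

theorem measurable_integral_activation {σ : ℝ → ℝ} (hσ : IsBoundedActivation σ)
    (m : Measure (S (n + 2))) [IsFiniteMeasure m] {h : S (n + 2) → ℝ} (hh : Measurable h) :
    Measurable fun x : S (n + 2) =>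
      ∫ θ : S (n + 2), σ ⟪(θ : E (n + 2)), (x : E (n + 2))⟫ * h θ ∂m := by
  have hm : Measurable fun z : S (n + 2) × S (n + 2) =>
      σ ⟪(z.1 : E (n + 2)), (z.2 : E (n + 2))⟫ * h z.1 :=
    (measurable_inner_sphere σ hσ.measurable (n + 2)).mul (hh.comp measurable_fst)
  exact (StronglyMeasurable.integral_prod_right (f := fun x θ : S (n + 2) =>
    σ ⟪(θ : E (n + 2)), (x : E (n + 2))⟫ * h θ)
    (hm.comp measurable_swap).stronglyMeasurable).measurable

theorem integrable_activation_mul {σ : ℝ → ℝ} (hσ : IsBoundedActivation σ)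
    {m : Measure (S (n + 2))} [IsFiniteMeasure m] {h : S (n + 2) → ℝ} (hi : Integrable h m)
    (x : S (n + 2)) :
    Integrable (fun θ : S (n + 2) => σ ⟪(θ : E (n + 2)), (x : E (n + 2))⟫ * h θ) m := by
  obtain ⟨M, -, hM⟩ := exists_bound (n := n) hσ
  refine hi.bdd_mul (c := M) ?_ (Filter.Eventually.of_forall fun θ => hM θ x)
  exact ((measurable_inner_sphere σ hσ.measurable (n + 2)).comp
    measurable_prodMk_right).aestronglyMeasurable

theorem exists_bound_integral_activation {σ : ℝ → ℝ} (hσ : IsBoundedActivation σ)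
    (m : Measure (S (n + 2))) [IsFiniteMeasure m] {h : S (n + 2) → ℝ} (hi : Integrable h m) :
    ∃ M : ℝ, ∀ x : S (n + 2),
      |∫ θ : S (n + 2), σ ⟪(θ : E (n + 2)), (x : E (n + 2))⟫ * h θ ∂m| ≤ M := by
  obtain ⟨M, hM0, hM⟩ := exists_bound (n := n) hσ
  refine ⟨∫ θ, M * |h θ| ∂m, fun x => abs_integral_le_integral_abs.trans ?_⟩
  refine integral_mono (integrable_activation_mul hσ hi x).abs (hi.abs.const_mul M) fun θ => ?_
  simp only [abs_mul]
  exact mul_le_mul_of_nonneg_right (hM θ x) (abs_nonneg _)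

/-- Fubini followed by Funk–Hecke. It is used with `h = 1` on the Jordan parts of a signed measure,
and with `L²` densities on `unif`. -/
theorem integral_integral_activation_mul_L {σ : ℝ → ℝ} (hσ : IsBoundedActivation σ) (k : ℕ)
    (m : Measure (S (n + 2))) [IsFiniteMeasure m] {h : S (n + 2) → ℝ} (hi : Integrable h m) :
    ∫ x : S (n + 2), (∫ θ : S (n + 2), σ ⟪(θ : E (n + 2)), (x : E (n + 2))⟫ * h θ ∂m) *
        L (n + 2) (k + 1) x ∂(unif (n + 2)) =
      eigenvalue n k σ * ∫ θ, h θ * L (n + 2) (k + 1) θ ∂m := by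
  obtain ⟨M, hM0, hM⟩ := exists_bound (n := n) hσ
  have hint : Integrable (fun z : S (n + 2) × S (n + 2) =>
      σ ⟪(z.2 : E (n + 2)), (z.1 : E (n + 2))⟫ * h z.2 * L (n + 2) (k + 1) z.1)
      ((unif (n + 2)).prod m) := by
    have h1 : Integrable (fun z : S (n + 2) × S (n + 2) => L (n + 2) (k + 1) z.1 * h z.2)
        ((unif (n + 2)).prod m) :=
      (integrable_of_continuous (continuous_L _ _)).mul_prod hi
    have h2 := h1.bdd_mul (c := M)
      (f := fun z : S (n + 2) × S (n + 2) => σ ⟪(z.2 : E (n + 2)), (z.1 : E (n + 2))⟫)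
      ((measurable_inner_sphere σ hσ.measurable (n + 2)).comp
        measurable_swap).aestronglyMeasurable (Filter.Eventually.of_forall fun z => hM z.2 z.1)
    refine h2.congr (Filter.Eventually.of_forall fun z => ?_)
    simp only
    ring
  simp only [← integral_mul_const]
  rw [integral_integral_swap hint, ← integral_const_mul]
  refine integral_congr_ae (Filter.Eventually.of_forall fun θ => ?_)
  simp only
  have : ∀ x : S (n + 2), σ ⟪(θ : E (n + 2)), (x : E (n + 2))⟫ * h θ * L (n + 2) (k + 1) x =
      h θ * (σ ⟪(θ : E (n + 2)), (x : E (n + 2))⟫ * L (n + 2) (k + 1) x) := fun x => by ring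
  simp only [this]
  rw [integral_const_mul, integral_activation_mul_L hσ]
  ring

theorem ipm_value_of_F1Rep {σ : ℝ → ℝ} (hσ : IsBoundedActivation σ) (k : ℕ)
    {f : S (n + 2) → ℝ} {γ : SignedMeasure (S (n + 2))} (h : F1Rep (n + 2) σ f γ) :
    (∫ x, f x ∂(muMeas (n + 2) (k + 1))) - ∫ x, f x ∂(nuMeas (n + 2) (k + 1)) =
      gammaConst (n + 2) (k + 1) * (eigenvalue n k σ * signedIntegral γ (L (n + 2) (k + 1))) := by
  obtain ⟨p, q, hp, hq⟩ : ∃ p q : Measure (S (n + 2)),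
      γ.toJordanDecomposition.posPart = p ∧ γ.toJordanDecomposition.negPart = q := ⟨_, _, rfl, rfl⟩
  have hpf : IsFiniteMeasure p := hp ▸ γ.toJordanDecomposition.posPart_finite
  have hqf : IsFiniteMeasure q := hq ▸ γ.toJordanDecomposition.negPart_finite
  obtain ⟨M₁, hM₁⟩ := exists_bound_integral_activation hσ p (integrable_const 1)
  obtain ⟨M₂, hM₂⟩ := exists_bound_integral_activation hσ q (integrable_const 1)
  have hm₁ := measurable_integral_activation hσ p (measurable_const (a := (1 : ℝ)))
  have hm₂ := measurable_integral_activation hσ q (measurable_const (a := (1 : ℝ)))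
  have hi₁ := integral_integral_activation_mul_L hσ k p (integrable_const 1)
  have hi₂ := integral_integral_activation_mul_L hσ k q (integrable_const 1)
  set f₁ : S (n + 2) → ℝ := fun x =>
    ∫ θ : S (n + 2), σ ⟪(θ : E (n + 2)), (x : E (n + 2))⟫ * 1 ∂p with hf₁
  set f₂ : S (n + 2) → ℝ := fun x =>
    ∫ θ : S (n + 2), σ ⟪(θ : E (n + 2)), (x : E (n + 2))⟫ * 1 ∂q with hf₂
  have hf : f = fun x => f₁ x - f₂ x := by
    ext x
    rw [h x, signedIntegral, hp, hq]
    simp only [hf₁, hf₂, mul_one]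
  rw [hf, integral_mu_sub_integral_nu (f := fun x => f₁ x - f₂ x) (hm₁.sub hm₂) (M := M₁ + M₂)
    fun x => (abs_sub _ _).trans (add_le_add (hM₁ x) (hM₂ x))]
  have hL := integrable_of_continuous (continuous_L (n + 2) (k + 1))
  have hs : ∫ x, (f₁ x - f₂ x) * L (n + 2) (k + 1) x ∂(unif (n + 2)) =
      eigenvalue n k σ * signedIntegral γ (L (n + 2) (k + 1)) := by
    simp only [sub_mul]
    rw [integral_sub (hL.bdd_mul hm₁.aestronglyMeasurable (Filter.Eventually.of_forall hM₁))
      (hL.bdd_mul hm₂.aestronglyMeasurable (Filter.Eventually.of_forall hM₂)), hi₁, hi₂,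
      signedIntegral, hp, hq]
    simp only [one_mul, mul_sub]
  rw [hs]

theorem abs_signedIntegral_L_le (γ : SignedMeasure (S (n + 2))) :
    |signedIntegral γ (L (n + 2) (k + 1))| ≤ tvNorm γ := by
  have hb : ∀ m : Measure (S (n + 2)), IsFiniteMeasure m →
      |∫ x, L (n + 2) (k + 1) x ∂m| ≤ m.real univ := by
    intro m _
    have := norm_integral_le_of_norm_le_const (μ := m) (f := L (n + 2) (k + 1)) (C := 1)
      (Filter.Eventually.of_forall (abs_L_le_one n k))
    simpa using this
  rw [signedIntegral, tvNorm, SignedMeasure.totalVariation, measureReal_add_apply]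
  exact (abs_sub _ _).trans (add_le_add (hb _ γ.toJordanDecomposition.posPart_finite)
    (hb _ γ.toJordanDecomposition.negPart_finite))

/-- Both norms are infima that need not be attained; this transfers a bound valid for every
representation. -/
theorem le_mul_sInf {s : Set ℝ} (hs : s.Nonempty) {a c : ℝ} (hc : 0 ≤ c)
    (h : ∀ r ∈ s, a ≤ c * r) : a ≤ c * sInf s := by
  rcases hc.eq_or_lt with rfl | hc
  · obtain ⟨r, hr⟩ := hs
    simpa using h r hr
  · rw [← div_le_iff₀' hc]
    exact le_csInf hs fun r hr => (div_le_iff₀' hc).2 (h r hr)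

theorem exists_abs_eq_one_mul (a : ℝ) : ∃ s : ℝ, |s| = 1 ∧ s * a = |a| := by
  rcases le_total 0 a with h | h
  · exact ⟨1, by simp, by rw [abs_of_nonneg h, one_mul]⟩
  · exact ⟨-1, by simp, by rw [abs_of_nonpos h]; ring⟩

/-- Built from a Jordan decomposition, so that its positive and negative parts are known. -/
theorem exists_signed_dirac {X : Type*} [MeasurableSpace X] (x : X) {s : ℝ} (hs : |s| = 1) :
    ∃ γ : SignedMeasure X, tvNorm γ = 1 ∧
      ∀ f : X → ℝ, Measurable f → signedIntegral γ f = s * f x := by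
  have hfin : IsFiniteMeasure (Measure.dirac x) := inferInstance
  rcases eq_or_eq_neg_of_abs_eq hs with rfl | rfl
  · let j : JordanDecomposition X := ⟨Measure.dirac x, 0, Measure.MutuallySingular.zero_right⟩
    refine ⟨j.toSignedMeasure, ?_, fun f hf => ?_⟩
    · rw [tvNorm, SignedMeasure.totalVariation,
        JordanDecomposition.toJordanDecomposition_toSignedMeasure]
      simp [j]
    · rw [signedIntegral, JordanDecomposition.toJordanDecomposition_toSignedMeasure]
      simp [j, integral_dirac' f x hf.stronglyMeasurable]
  · let j : JordanDecomposition X := ⟨0, Measure.dirac x, Measure.MutuallySingular.zero_left⟩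
    refine ⟨j.toSignedMeasure, ?_, fun f hf => ?_⟩
    · rw [tvNorm, SignedMeasure.totalVariation,
        JordanDecomposition.toJordanDecomposition_toSignedMeasure]
      simp [j]
    · rw [signedIntegral, JordanDecomposition.toJordanDecomposition_toSignedMeasure]
      simp [j, integral_dirac' f x hf.stronglyMeasurable]

theorem F1norm_le {d : ℕ} {σ : ℝ → ℝ} {f : S d → ℝ} {γ : SignedMeasure (S d)}
    (h : F1Rep d σ f γ) : F1norm d σ f ≤ tvNorm γ := by
  refine csInf_le ⟨0, ?_⟩ ⟨γ, h, rfl⟩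
  rintro r ⟨γ', -, rfl⟩
  exact ENNReal.toReal_nonneg

theorem sInf_sq_le {d : ℕ} {σ : ℝ → ℝ} {f h : S d → ℝ} (hf : F2Rep d σ f h) :
    sInf {r | ∃ h, F2Rep d σ f h ∧ r = ∫ θ, h θ ^ 2 ∂(unif d)} ≤ ∫ θ, h θ ^ 2 ∂(unif d) := by
  refine csInf_le ⟨0, ?_⟩ ⟨h, hf, rfl⟩
  rintro r ⟨h', -, rfl⟩
  exact integral_nonneg fun _ => sq_nonneg _

theorem isGreatest_ipmValues_F1 {σ : ℝ → ℝ} (hσ : IsBoundedActivation σ) (n k : ℕ) :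
    IsGreatest (ipmValues (F1ball (n + 2) σ) (muMeas (n + 2) (k + 1)) (nuMeas (n + 2) (k + 1)))
      (gammaConst (n + 2) (k + 1) * |eigenvalue n k σ|) := by
  have hγ := gammaConst_pos n k
  constructor
  · obtain ⟨s, hs, hsl⟩ := exists_abs_eq_one_mul (eigenvalue n k σ)
    -- The extremal measure: the Dirac mass at the pole, where `L = 1` is maximal, with the sign of
    -- the eigenvalue.
    obtain ⟨γ, htv, hγs⟩ := exists_signed_dirac (pole n) hs
    have hrep : F1Rep (n + 2) σ
        (fun x => signedIntegral γ fun θ => σ ⟪(θ : E (n + 2)), (x : E (n + 2))⟫) γ := fun _ => rfl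
    refine ⟨_, ⟨⟨γ, hrep⟩, ?_⟩, ?_⟩
    · exact (F1norm_le hrep).trans_eq htv
    · simp only
      rw [ipm_value_of_F1Rep hσ k hrep, hγs _ (continuous_L _ _).measurable, ← hsl]
      have hL1 : L (n + 2) (k + 1) (pole n) = 1 := (isLegendreHarmonic n k).normalized
      rw [hL1]
      ring
  · rintro _ ⟨f, ⟨⟨γ, hγf⟩, hf⟩, rfl⟩
    have h1 : ∀ r ∈ {r | ∃ γ, F1Rep (n + 2) σ f γ ∧ r = tvNorm γ},
        (∫ x, f x ∂(muMeas (n + 2) (k + 1))) - ∫ x, f x ∂(nuMeas (n + 2) (k + 1)) ≤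
          (gammaConst (n + 2) (k + 1) * |eigenvalue n k σ|) * r := by
      rintro r ⟨γ, hrep, rfl⟩
      rw [ipm_value_of_F1Rep hσ k hrep, mul_assoc]
      refine mul_le_mul_of_nonneg_left ((le_abs_self _).trans ?_) hγ.le
      rw [abs_mul]
      exact mul_le_mul_of_nonneg_left (abs_signedIntegral_L_le γ) (abs_nonneg _)
    have hnn : 0 ≤ gammaConst (n + 2) (k + 1) * |eigenvalue n k σ| := by positivity
    exact (le_mul_sInf (s := {r | ∃ γ, F1Rep (n + 2) σ f γ ∧ r = tvNorm γ})
      ⟨_, ⟨γ, hγf, rfl⟩⟩ hnn h1).trans (mul_le_of_le_one_right hnn hf)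

theorem ipm_value_of_F2Rep {σ : ℝ → ℝ} (hσ : IsBoundedActivation σ) (k : ℕ)
    {f h : S (n + 2) → ℝ} (hf : F2Rep (n + 2) σ f h) :
    (∫ x, f x ∂(muMeas (n + 2) (k + 1))) - ∫ x, f x ∂(nuMeas (n + 2) (k + 1)) =
      gammaConst (n + 2) (k + 1) *
        (eigenvalue n k σ * ∫ x, h x * L (n + 2) (k + 1) x ∂(unif (n + 2))) := by
  obtain ⟨hmem, hrep⟩ := hf
  -- `h` is only almost everywhere measurable; the Fubini step uses a measurable representative.
  obtain ⟨g, hg, hhg⟩ := hmem.1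
  have hgi : Integrable g (unif (n + 2)) := (hmem.integrable one_le_two).congr hhg
  have hfg : f = fun x : S (n + 2) =>
      ∫ θ, σ ⟪(θ : E (n + 2)), (x : E (n + 2))⟫ * g θ ∂(unif (n + 2)) := by
    ext x
    rw [hrep x]
    refine integral_congr_ae ?_
    filter_upwards [hhg] with θ hθ
    rw [hθ]
  have hgl : ∫ x, h x * L (n + 2) (k + 1) x ∂(unif (n + 2)) =
      ∫ x, g x * L (n + 2) (k + 1) x ∂(unif (n + 2)) := by
    refine integral_congr_ae ?_
    filter_upwards [hhg] with θ hθ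
    rw [hθ]
  obtain ⟨M, hM⟩ := exists_bound_integral_activation hσ _ hgi
  rw [hgl, hfg, integral_mu_sub_integral_nu
    (measurable_integral_activation hσ _ hg.measurable) hM,
    integral_integral_activation_mul_L hσ k _ hgi]

/-- Cauchy–Schwarz with `‖L‖² = 1 / N`, by expanding `‖h - c L‖² ≥ 0` at the projection coefficient
`c = N ⟨h, L⟩`. -/
theorem sq_integral_mul_L_le {h : S (n + 2) → ℝ} (hh : MemLp h 2 (unif (n + 2))) :
    (∫ x, h x * L (n + 2) (k + 1) x ∂(unif (n + 2))) ^ 2 * N (n + 2) (k + 1) ≤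
      ∫ x, h x ^ 2 ∂(unif (n + 2)) := by
  set a := ∫ x, h x * L (n + 2) (k + 1) x ∂(unif (n + 2)) with ha
  set c := N (n + 2) (k + 1) * a with hc
  have hL := continuous_L (n + 2) (k + 1)
  have hi1 : Integrable (fun x => h x ^ 2) (unif (n + 2)) := hh.integrable_sq
  have hi2 : Integrable (fun x => h x * L (n + 2) (k + 1) x) (unif (n + 2)) :=
    (hh.integrable one_le_two).mul_bdd hL.aestronglyMeasurable
      (Filter.Eventually.of_forall (abs_L_le_one n k))
  have hi3 : Integrable (fun x => L (n + 2) (k + 1) x ^ 2) (unif (n + 2)) :=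
    integrable_of_continuous (hL.pow 2)
  have h0 : 0 ≤ ∫ x, (h x - c * L (n + 2) (k + 1) x) ^ 2 ∂(unif (n + 2)) :=
    integral_nonneg fun x => sq_nonneg _
  have hexp : ∀ x, (h x - c * L (n + 2) (k + 1) x) ^ 2 =
      h x ^ 2 - 2 * c * (h x * L (n + 2) (k + 1) x) + c ^ 2 * L (n + 2) (k + 1) x ^ 2 :=
    fun x => by ring
  simp only [hexp] at h0
  have hi12 : Integrable (fun x => h x ^ 2 - 2 * c * (h x * L (n + 2) (k + 1) x))
      (unif (n + 2)) := hi1.sub (hi2.const_mul _)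
  rw [integral_add hi12 (hi3.const_mul _), integral_sub hi1 (hi2.const_mul _), integral_const_mul, integral_const_mul] at h0
  have hN := integral_L_sq n k
  set I := ∫ x, L (n + 2) (k + 1) x ^ 2 ∂(unif (n + 2))
  have : c ^ 2 * I = a * c := by
    rw [hc]; linear_combination (N (n + 2) (k + 1) * a ^ 2 : ℝ) * hN
  rw [this, ← ha] at h0
  have : c * a = a ^ 2 * N (n + 2) (k + 1) := by rw [hc]; ring
  nlinarith

theorem isGreatest_ipmValues_F2 {σ : ℝ → ℝ} (hσ : IsBoundedActivation σ) (n k : ℕ) :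
    IsGreatest (ipmValues (F2ball (n + 2) σ) (muMeas (n + 2) (k + 1)) (nuMeas (n + 2) (k + 1)))
      (gammaConst (n + 2) (k + 1) * |eigenvalue n k σ| / √(N (n + 2) (k + 1))) := by
  have hγ := gammaConst_pos n k
  have hN : (0 : ℝ) < N (n + 2) (k + 1) := by
    have := two_le_N n k
    positivity
  have hNs : (0 : ℝ) < √(N (n + 2) (k + 1)) := Real.sqrt_pos.2 hN
  have hNN : √(N (n + 2) (k + 1) : ℝ) ^ 2 = N (n + 2) (k + 1) := Real.sq_sqrt hN.le
  have hsq := integral_L_sq n k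
  have hL := continuous_L (n + 2) (k + 1)
  constructor
  · obtain ⟨s, hs, hsl⟩ := exists_abs_eq_one_mul (eigenvalue n k σ)
    have hs2 : s ^ 2 = 1 := by rw [← sq_abs, hs, one_pow]
    -- Equality case of Cauchy–Schwarz: `√N L` is a unit vector, given the sign of the eigenvalue.
    set h : S (n + 2) → ℝ := fun x => (s * √(N (n + 2) (k + 1))) * L (n + 2) (k + 1) x with hh
    have hrep : F2Rep (n + 2) σ
        (fun x => ∫ θ, σ ⟪(θ : E (n + 2)), (x : E (n + 2))⟫ * h θ ∂(unif (n + 2))) h := by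
      refine ⟨?_, fun _ => rfl⟩
      refine MemLp.of_bound (hL.const_mul _).aestronglyMeasurable (√(N (n + 2) (k + 1)))
        (Filter.Eventually.of_forall fun x => ?_)
      rw [Real.norm_eq_abs, abs_mul, abs_mul, hs, one_mul, abs_of_pos hNs]
      exact mul_le_of_le_one_right hNs.le (abs_L_le_one n k x)
    refine ⟨_, ⟨⟨h, hrep⟩, ?_⟩, ?_⟩
    · rw [F2norm, Real.sqrt_le_one]
      refine (sInf_sq_le hrep).trans_eq ?_
      simp only [hh, mul_pow, hs2, hNN, one_mul]
      rw [integral_const_mul, hsq]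
    · simp only
      rw [ipm_value_of_F2Rep hσ k hrep]
      have : ∀ x, h x * L (n + 2) (k + 1) x =
          (s * √(N (n + 2) (k + 1))) * L (n + 2) (k + 1) x ^ 2 := fun x => by rw [hh]; ring
      simp only [this]
      rw [integral_const_mul, eq_div_iff hNs.ne', ← hsl]
      linear_combination (gammaConst (n + 2) (k + 1) * eigenvalue n k σ * s) * hsq +
        (gammaConst (n + 2) (k + 1) * eigenvalue n k σ * s *
          ∫ x, L (n + 2) (k + 1) x ^ 2 ∂(unif (n + 2))) * hNN
  · rintro _ ⟨f, ⟨⟨h, hhf⟩, hf⟩, rfl⟩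
    set V := (∫ x, f x ∂(muMeas (n + 2) (k + 1))) - ∫ x, f x ∂(nuMeas (n + 2) (k + 1)) with hV
    -- The comparison is made on squares because the norm is the square root of the infimum.
    have h1 : ∀ r ∈ {r | ∃ h, F2Rep (n + 2) σ f h ∧ r = ∫ θ, h θ ^ 2 ∂(unif (n + 2))},
        V ^ 2 * N (n + 2) (k + 1) ≤ (gammaConst (n + 2) (k + 1) * |eigenvalue n k σ|) ^ 2 * r := by
      rintro r ⟨h, hrep, rfl⟩
      rw [hV, ipm_value_of_F2Rep hσ k hrep, ← mul_assoc, mul_pow, mul_pow, mul_pow, sq_abs,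
        mul_assoc]
      exact mul_le_mul_of_nonneg_left (sq_integral_mul_L_le hrep.1) (by positivity)
    have h2 := le_mul_sInf (s := {r | ∃ h, F2Rep (n + 2) σ f h ∧ r = ∫ θ, h θ ^ 2 ∂(unif (n + 2))})
      ⟨_, ⟨h, hhf, rfl⟩⟩ (sq_nonneg _) h1
    have h3 : sInf {r | ∃ h, F2Rep (n + 2) σ f h ∧ r = ∫ θ, h θ ^ 2 ∂(unif (n + 2))} ≤ 1 :=
      Real.sqrt_le_one.1 hf
    have h4 := h2.trans (mul_le_of_le_one_right (sq_nonneg _) h3)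
    rw [le_div_iff₀ hNs]
    refine le_of_sq_le_sq ?_ (by positivity)
    rw [mul_pow, hNN]
    exact h4

theorem d1_eq {σ : ℝ → ℝ} (hσ : IsBoundedActivation σ) (n k : ℕ) :
    d1 (n + 2) (k + 1) σ = gammaConst (n + 2) (k + 1) * |eigenvalue n k σ| :=
  (isGreatest_ipmValues_F1 hσ n k).csSup_eq

theorem d2_eq {σ : ℝ → ℝ} (hσ : IsBoundedActivation σ) (n k : ℕ) :
    d2 (n + 2) (k + 1) σ =
      gammaConst (n + 2) (k + 1) * |eigenvalue n k σ| / √(N (n + 2) (k + 1)) :=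
  (isGreatest_ipmValues_F2 hσ n k).csSup_eq

theorem d1_eq_weightedIntegral {σ : ℝ → ℝ} (hσ : IsBoundedActivation σ) (n k : ℕ) :
    d1 (n + 2) (k + 1) σ =
      2 * |weightedIntegral (n + 2) fun t => P (n + 2) (k + 1) t * σ t| /
        weightedIntegral (n + 2) fun t => |P (n + 2) (k + 1) t| := by
  obtain ⟨c, hc, h1, h2⟩ := exists_eigenvalue_eq n k
  have hpos := integral_abs_L_pos n k
  rw [d1_eq hσ, gammaConst, h1 σ hσ.measurable, h2, abs_mul, abs_of_pos hc]
  rw [h2] at hpos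
  have := (pos_of_mul_pos_right hpos hc.le).ne'
  field_simp

theorem d1_eq_sqrt_mul_d2 {σ : ℝ → ℝ} (hσ : IsBoundedActivation σ) (n k : ℕ) :
    d1 (n + 2) (k + 1) σ = √(N (n + 2) (k + 1) : ℝ) * d2 (n + 2) (k + 1) σ := by
  have hN : (0 : ℝ) < N (n + 2) (k + 1) := by
    have := two_le_N n k
    positivity
  rw [d1_eq hσ, d2_eq hσ, mul_div_cancel₀ _ (Real.sqrt_pos.2 hN).ne']

theorem d2_pos {σ : ℝ → ℝ} (hσ : IsBoundedActivation σ) (n k : ℕ)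
    (h : (weightedIntegral (n + 2) fun t => P (n + 2) (k + 1) t * σ t) ≠ 0) :
    0 < d2 (n + 2) (k + 1) σ := by
  have hN : (0 : ℝ) < N (n + 2) (k + 1) := by
    have := two_le_N n k
    positivity
  obtain ⟨c, hc, h1, -⟩ := exists_eigenvalue_eq n k
  rw [d2_eq hσ, h1 σ hσ.measurable]
  exact div_pos (mul_pos (gammaConst_pos n k) (abs_pos.2 (mul_ne_zero hc.ne' h)))
    (Real.sqrt_pos.2 hN)

end

/-! ### Asymptotics of the dimension -/

/-- One term of the exponential series: `j^j / j! ≤ e^j`. -/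
theorem le_log_factorial (j : ℕ) : (j : ℝ) * Real.log j - j ≤ Real.log (j ! : ℝ) := by
  rcases Nat.eq_zero_or_pos j with rfl | hj
  · simp
  have hj' : (0 : ℝ) < j := by exact_mod_cast hj
  have hf : (0 : ℝ) < (j ! : ℝ) := by positivity
  have h := Real.pow_div_factorial_le_exp (j : ℝ) hj'.le j
  have h2 := Real.log_le_log (by positivity) h
  rw [Real.log_exp, Real.log_div (by positivity) hf.ne', Real.log_pow] at h2
  linarith

/-- The induction step reduces to `(j + 1) log (j / (j + 1)) ≤ -1`. -/
theorem log_factorial_le (j : ℕ) :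
    Real.log (j ! : ℝ) ≤ (j : ℝ) * Real.log j - j + Real.log j + 1 := by
  rcases Nat.eq_zero_or_pos j with rfl | hj
  · simp
  induction j, hj using Nat.le_induction with
  | base => simp
  | succ j hj ih =>
    have hj' : (0 : ℝ) < j := by exact_mod_cast hj
    have hf : (0 : ℝ) < (j ! : ℝ) := by positivity
    have h1 : Real.log ((j : ℝ) / (j + 1)) ≤ (j : ℝ) / (j + 1) - 1 :=
      Real.log_le_sub_one_of_pos (by positivity)
    rw [Real.log_div hj'.ne' (by positivity)] at h1
    have h2 : ((j : ℝ) + 1) * ((j : ℝ) / (j + 1) - 1) = -1 := by field_simp; ring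
    have h3 := mul_le_mul_of_nonneg_left h1 (by positivity : (0 : ℝ) ≤ (j : ℝ) + 1)
    rw [h2] at h3
    rw [Nat.factorial_succ, Nat.cast_mul, Real.log_mul (by positivity) hf.ne']
    push_cast
    linarith

/-- Take logarithms in `N (k+1)! n! = (2(k+1)+n) (k+n)!` and bound each factorial; the main terms
cancel, leaving a bounded number of logarithms and constants. The constant `10` is not optimized. -/
theorem abs_log_N_sub_le (n k : ℕ) (h4 : 4 ≤ (k + 1) + (n + 2)) :
    |Real.log (N (n + 2) (k + 1)) -
        (((k + 1 : ℕ) : ℝ) * Real.log (((k + 1 : ℕ) + (n + 2 : ℕ) - 3 : ℝ) / (k + 1 : ℕ)) +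
          ((n + 2 : ℕ) - 2 : ℝ) *
            Real.log (((k + 1 : ℕ) + (n + 2 : ℕ) - 3 : ℝ) / ((n + 2 : ℕ) - 2 : ℝ)))| ≤
      10 * Real.log ((k + 1 : ℕ) + (n + 2 : ℕ) : ℝ) := by
  have hm1 : 1 ≤ k + n := by omega
  have hm : (0 : ℝ) < ((k + n : ℕ) : ℝ) := by exact_mod_cast hm1
  have e1 : (((k + 1 : ℕ) : ℝ) + ((n + 2 : ℕ) : ℝ) - 3) = ((k + n : ℕ) : ℝ) := by
    push_cast; ring
  have e2 : ((n + 2 : ℕ) : ℝ) - 2 = n := by push_cast; ring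
  have e3 : ((k + 1 : ℕ) : ℝ) + ((n + 2 : ℕ) : ℝ) = ((k + n + 3 : ℕ) : ℝ) := by push_cast; ring
  rw [e1, e2, e3]
  set ℓ := Real.log ((k + n + 3 : ℕ) : ℝ) with hℓ
  have hlog : ∀ j : ℕ, j ≤ k + n + 3 → 0 ≤ Real.log (j : ℝ) ∧ Real.log (j : ℝ) ≤ ℓ := by
    intro j hj
    refine ⟨Real.log_natCast_nonneg j, ?_⟩
    rcases Nat.eq_zero_or_pos j with rfl | hj0
    · rw [Nat.cast_zero, Real.log_zero]
      exact Real.log_natCast_nonneg (k + n + 3)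
    · exact Real.log_le_log (by exact_mod_cast hj0) (by exact_mod_cast hj)
  -- As `k + n + 3 ≥ 4 > e`, additive constants can be absorbed into multiples of `ℓ`.
  have hℓ1 : 1 ≤ ℓ := by
    rw [hℓ, Real.le_log_iff_exp_le (by positivity)]
    have h3 : (4 : ℝ) ≤ ((k + n + 3 : ℕ) : ℝ) := by exact_mod_cast (by omega : 4 ≤ k + n + 3)
    linarith [Real.exp_one_lt_d9]
  have hNpos : (0 : ℝ) < N (n + 2) (k + 1) := by
    have := two_le_N n k
    positivity
  have hNlog : Real.log (N (n + 2) (k + 1)) + (Real.log ((k + 1)! : ℝ) + Real.log (n ! : ℝ)) =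
      Real.log ((2 * (k + 1) + n : ℕ) : ℝ) + Real.log ((k + n)! : ℝ) := by
    have h := congrArg (fun a : ℕ => Real.log (a : ℝ)) (N_mul_factorial n k)
    simp only [Nat.cast_mul] at h
    rw [Real.log_mul hNpos.ne' (by positivity), Real.log_mul (by positivity) (by positivity),
      Real.log_mul (by positivity) (by positivity)] at h
    exact h
  have hd1 : Real.log (((k + n : ℕ) : ℝ) / ((k + 1 : ℕ) : ℝ)) =
      Real.log ((k + n : ℕ) : ℝ) - Real.log ((k + 1 : ℕ) : ℝ) :=
    Real.log_div hm.ne' (by positivity)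
  have hd2 : (n : ℝ) * Real.log (((k + n : ℕ) : ℝ) / (n : ℝ)) =
      n * (Real.log ((k + n : ℕ) : ℝ) - Real.log (n : ℝ)) := by
    rcases Nat.eq_zero_or_pos n with rfl | hn
    · simp
    · rw [Real.log_div hm.ne' (by positivity)]
  have hbig : 0 ≤ Real.log ((2 * (k + 1) + n : ℕ) : ℝ) ∧
      Real.log ((2 * (k + 1) + n : ℕ) : ℝ) ≤ 2 * ℓ := by
    refine ⟨Real.log_natCast_nonneg _, ?_⟩
    rw [hℓ, ← Real.log_rpow (by positivity), Real.rpow_ofNat]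
    refine Real.log_le_log (by positivity) ?_
    have : 2 * (k + 1) + n ≤ (k + n + 3) ^ 2 := by nlinarith
    exact_mod_cast this
  have l1 := hlog (k + n) (by omega)
  have l2 := hlog (k + 1) (by omega)
  have l3 := hlog n (by omega)
  have a1 := le_log_factorial (k + n)
  have a2 := le_log_factorial (k + 1)
  have a3 := le_log_factorial n
  have b1 := log_factorial_le (k + n)
  have b2 := log_factorial_le (k + 1)
  have b3 := log_factorial_le n
  rw [hd1, hd2]
  -- The factorial has argument `k + n`, one less than the sum of the two weights; the discrepancy
  -- costs one logarithm.
  have hkn : ((k + n : ℕ) : ℝ) = ((k + 1 : ℕ) : ℝ) + n - 1 := by push_cast; ring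
  have hmul : ((k + n : ℕ) : ℝ) * Real.log ((k + n : ℕ) : ℝ) =
      ((k + 1 : ℕ) : ℝ) * Real.log ((k + n : ℕ) : ℝ) + n * Real.log ((k + n : ℕ) : ℝ) -
        Real.log ((k + n : ℕ) : ℝ) := by
    rw [show ((k + n : ℕ) : ℝ) * Real.log ((k + n : ℕ) : ℝ) =
      (((k + 1 : ℕ) : ℝ) + n - 1) * Real.log ((k + n : ℕ) : ℝ) by rw [← hkn]]
    ring
  rw [hmul] at a1 b1
  rw [abs_le]
  constructor <;> linarith

/-! ### Exponential bounds on `N` through binomial coefficients. -/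

/-- The binomial is the product of `(K + j) / j` over `1 ≤ j ≤ n`, and each factor is at least `1 +
t`. -/
theorem pow_le_choose_add {t : ℝ} (ht : 0 ≤ t) {K n : ℕ} (h : t * n ≤ K) :
    (1 + t) ^ n ≤ ((K + n).choose n : ℝ) := by
  have key : ∀ j ≤ n, (1 + t) ^ j ≤ ((K + j).choose j : ℝ) := by
    intro j
    induction j with
    | zero => simp
    | succ j ih =>
      intro hj
      have h1 := ih (by omega)
      have h2 := congrArg (Nat.cast (R := ℝ)) (Nat.add_one_mul_choose_eq (K + j) j)
      push_cast at h2
      have h3 : t * (j + 1) ≤ K := by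
        refine le_trans (mul_le_mul_of_nonneg_left ?_ ht) h
        exact_mod_cast hj
      have h4 : (0 : ℝ) ≤ (1 + t) ^ j := by positivity
      rw [← add_assoc, pow_succ, ← mul_le_mul_iff_of_pos_right (by positivity : (0 : ℝ) < j + 1),
        ← h2]
      calc (1 + t) ^ j * (1 + t) * (j + 1) = ((1 + t) * (j + 1)) * (1 + t) ^ j := by ring
        _ ≤ (K + j + 1) * ((K + j).choose j : ℝ) := by
          refine mul_le_mul ?_ h1 h4 (by positivity)
          linarith
  exact key n le_rfl

/-- With `N_le_two_mul_choose` this pins `N` to a binomial up to a factor `2`, because `2(k+1)+n`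
lies between `k+n+1` and its double. -/
theorem choose_le_N (n k : ℕ) : (k + 1 + n).choose n ≤ N (n + 2) (k + 1) := by
  have h := N_mul_factorial n k
  have h1 := Nat.add_choose_mul_factorial_mul_factorial (k + 1) n
  have h2 : (k + 1 + n)! ≤ (2 * (k + 1) + n) * (k + n)! := by
    rw [show k + 1 + n = k + n + 1 by omega, Nat.factorial_succ]
    exact Nat.mul_le_mul_right _ (by omega)
  rw [← h, ← h1, mul_assoc] at h2
  exact Nat.le_of_mul_le_mul_right h2 (by positivity)

theorem N_le_two_mul_choose (n k : ℕ) : N (n + 2) (k + 1) ≤ 2 * (k + 1 + n).choose n := by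
  have h := N_mul_factorial n k
  have h1 := Nat.add_choose_mul_factorial_mul_factorial (k + 1) n
  have h2 : (2 * (k + 1) + n) * (k + n)! ≤ 2 * (k + 1 + n)! := by
    rw [show k + 1 + n = k + n + 1 by omega, Nat.factorial_succ, ← mul_assoc]
    exact Nat.mul_le_mul_right _ (by omega)
  rw [← h, ← h1, mul_assoc, ← mul_assoc 2] at h2
  exact Nat.le_of_mul_le_mul_right h2 (by positivity)

theorem N_le_exp (n k : ℕ) :
    (N (n + 2) (k + 1) : ℝ) ≤ Real.exp (((k + 1 : ℕ) : ℝ) + ((n + 2 : ℕ) : ℝ)) := by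
  have h1 : N (n + 2) (k + 1) ≤ 2 ^ (k + 1 + (n + 2)) := by
    refine (N_le_two_mul_choose n k).trans ?_
    have := Nat.choose_le_two_pow (k + 1 + n) n
    have h2 : 2 ^ (k + 1 + (n + 2)) = 4 * 2 ^ (k + 1 + n) := by ring
    omega
  have h2 : (2 : ℝ) ≤ Real.exp 1 := by linarith [Real.exp_one_gt_d9]
  calc (N (n + 2) (k + 1) : ℝ) ≤ 2 ^ (k + 1 + (n + 2)) := by exact_mod_cast h1
    _ ≤ Real.exp 1 ^ (k + 1 + (n + 2)) := by gcongr
    _ = _ := by rw [← Real.exp_nat_mul]; push_cast; ring_nf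

/-- The factor `2` in the exponent anticipates the square root of `N`. For `n ≤ 1` the bound `N ≥ 2`
suffices, as `2 · (log 2 / 6) · 3 = log 2`; for `n ≥ 2` one uses `(1 + c)^n` and `n + 2 ≤ 2n`. -/
theorem exp_le_N {c : ℝ} (hc : 0 < c) {n k : ℕ} (h : c * ((n + 2 : ℕ) : ℝ) ≤ ((k + 1 : ℕ) : ℝ)) :
    Real.exp (2 * (min (Real.log (1 + c) / 4) (Real.log 2 / 6) * ((n + 2 : ℕ) : ℝ))) ≤
      N (n + 2) (k + 1) := by
  set a := min (Real.log (1 + c) / 4) (Real.log 2 / 6) with ha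
  have ha1 : a ≤ Real.log (1 + c) / 4 := min_le_left _ _
  have ha2 : a ≤ Real.log 2 / 6 := min_le_right _ _
  have hl2 : 0 < Real.log 2 := Real.log_pos one_lt_two
  have hlc : 0 < Real.log (1 + c) := Real.log_pos (by linarith)
  rcases le_or_gt n 1 with hn | hn
  · have hn' : (n : ℝ) ≤ 1 := by exact_mod_cast hn
    have h2 : (2 : ℝ) ≤ N (n + 2) (k + 1) := by exact_mod_cast two_le_N n k
    refine le_trans ?_ h2
    rw [← Real.le_log_iff_exp_le two_pos]
    push_cast
    have : a * (n + 2) ≤ Real.log 2 / 6 * 3 :=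
      mul_le_mul ha2 (by linarith) (by positivity) (by positivity)
    linarith
  · have hn' : (2 : ℝ) ≤ n := by exact_mod_cast hn
    have h1 : c * (n : ℝ) ≤ ((k + 1 : ℕ) : ℝ) :=
      le_trans (mul_le_mul_of_nonneg_left (by push_cast; linarith) hc.le) h
    have h2 : (((k + 1 + n).choose n : ℕ) : ℝ) ≤ N (n + 2) (k + 1) := by
      exact_mod_cast choose_le_N n k
    refine le_trans ?_ ((pow_le_choose_add hc.le h1).trans h2)
    rw [← Real.le_log_iff_exp_le (by positivity), Real.log_pow]
    push_cast
    have h3 : a * ((n : ℝ) + 2) ≤ Real.log (1 + c) / 4 * (n + 2) :=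
      mul_le_mul_of_nonneg_right ha1 (by positivity)
    nlinarith

end SphereIPM

end

/-! ### Assembly of the exact formulas and the asymptotics. -/

theorem theorem2 :
    -- exact formulas, for every dimension, degree and activation
    (∀ d k : ℕ, 2 ≤ d → 1 ≤ k →
      (∃! p : MvPolynomial (Fin d) ℝ, SphereIPM.IsLegendreHarmonic d k p) ∧
      IsProbabilityMeasure (SphereIPM.muMeas d k) ∧
      IsProbabilityMeasure (SphereIPM.nuMeas d k) ∧
      (SphereIPM.N d k : ℝ) =
        (2 * (k : ℝ) + (d : ℝ) - 2) * ((k + d - 3)! : ℝ) / ((k ! : ℝ) * ((d - 2)! : ℝ)) ∧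
      ∀ σ : ℝ → ℝ, SphereIPM.IsBoundedActivation σ →
        BddAbove (SphereIPM.ipmValues (SphereIPM.F1ball d σ)
          (SphereIPM.muMeas d k) (SphereIPM.nuMeas d k)) ∧
        BddAbove (SphereIPM.ipmValues (SphereIPM.F2ball d σ)
          (SphereIPM.muMeas d k) (SphereIPM.nuMeas d k)) ∧
        SphereIPM.d1 d k σ =
          2 * |(SphereIPM.weightedIntegral d fun t => SphereIPM.P d k t * σ t)| /
            (SphereIPM.weightedIntegral d fun t => |SphereIPM.P d k t|) ∧
        SphereIPM.d1 d k σ = √(SphereIPM.N d k : ℝ) * SphereIPM.d2 d k σ ∧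
        ((SphereIPM.weightedIntegral d fun t => SphereIPM.P d k t * σ t) ≠ 0 →
          0 < SphereIPM.d2 d k σ ∧
          SphereIPM.d1 d k σ / SphereIPM.d2 d k σ = √(SphereIPM.N d k : ℝ))) ∧
    -- logarithmic asymptotics, with an absolute constant
    (∃ C : ℝ, ∀ d k : ℕ, 2 ≤ d → 1 ≤ k → 4 ≤ k + d →
      ∀ σ : ℝ → ℝ, SphereIPM.IsBoundedActivation σ →
        (SphereIPM.weightedIntegral d fun t => SphereIPM.P d k t * σ t) ≠ 0 →
        |Real.log (SphereIPM.d1 d k σ / SphereIPM.d2 d k σ) -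
            1 / 2 * ((k : ℝ) * Real.log (((k : ℝ) + d - 3) / k) +
              ((d : ℝ) - 2) * Real.log (((k : ℝ) + d - 3) / ((d : ℝ) - 2)))| ≤
          C * Real.log ((k : ℝ) + d)) ∧
    -- for `k` of the same order as `d`, the ratio is exponential in `d`
    (∀ c₁ c₂ : ℝ, 0 < c₁ → c₁ ≤ c₂ → ∃ a b : ℝ, 0 < a ∧ 0 < b ∧
      ∀ d k : ℕ, 2 ≤ d → 1 ≤ k → c₁ * d ≤ k → (k : ℝ) ≤ c₂ * d →
        ∀ σ : ℝ → ℝ, SphereIPM.IsBoundedActivation σ →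
          (SphereIPM.weightedIntegral d fun t => SphereIPM.P d k t * σ t) ≠ 0 →
          Real.exp (a * d) ≤ SphereIPM.d1 d k σ / SphereIPM.d2 d k σ ∧
            SphereIPM.d1 d k σ / SphereIPM.d2 d k σ ≤ Real.exp (b * d)) := by
  have ratio : ∀ n k : ℕ, ∀ σ : ℝ → ℝ, SphereIPM.IsBoundedActivation σ →
      (SphereIPM.weightedIntegral (n + 2) fun t => SphereIPM.P (n + 2) (k + 1) t * σ t) ≠ 0 →
      SphereIPM.d1 (n + 2) (k + 1) σ / SphereIPM.d2 (n + 2) (k + 1) σ =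
        √(SphereIPM.N (n + 2) (k + 1) : ℝ) := by
    intro n k σ hσ h
    rw [SphereIPM.d1_eq_sqrt_mul_d2 hσ, mul_div_cancel_right₀ _ (SphereIPM.d2_pos hσ n k h).ne']
  -- The constant `5` is half of the `10` for `log N`; `b = c₂ + 1` comes from `k + d ≤ (c₂ + 1) d`.
  refine ⟨fun d k hd hk => ?_, ⟨5, fun d k hd hk h4 σ hσ h => ?_⟩,
    fun c₁ c₂ hc₁ hc => ⟨min (Real.log (1 + c₁) / 4) (Real.log 2 / 6), c₂ + 1, ?_, by linarith,
      fun d k hd hk h1 h2 σ hσ h => ?_⟩⟩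
  · have hN := SphereIPM.N_formula hd hk
    obtain ⟨n, rfl⟩ := Nat.exists_eq_add_of_le' hd
    obtain ⟨k, rfl⟩ := Nat.exists_eq_add_of_le' hk
    exact ⟨SphereIPM.existsUnique_isLegendreHarmonic n k, SphereIPM.isProbabilityMeasure_muMeas n k,
      SphereIPM.isProbabilityMeasure_nuMeas n k, hN, fun σ hσ =>
        ⟨(SphereIPM.isGreatest_ipmValues_F1 hσ n k).bddAbove,
          (SphereIPM.isGreatest_ipmValues_F2 hσ n k).bddAbove,
          SphereIPM.d1_eq_weightedIntegral hσ n k, SphereIPM.d1_eq_sqrt_mul_d2 hσ n k,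
          fun h => ⟨SphereIPM.d2_pos hσ n k h, ratio n k σ hσ h⟩⟩⟩
  · obtain ⟨n, rfl⟩ := Nat.exists_eq_add_of_le' hd
    obtain ⟨k, rfl⟩ := Nat.exists_eq_add_of_le' hk
    rw [ratio n k σ hσ h, Real.log_sqrt (by positivity)]
    have hb := abs_le.1 (SphereIPM.abs_log_N_sub_le n k h4)
    rw [abs_le]
    constructor <;> linarith [hb.1, hb.2]
  · exact lt_min (div_pos (Real.log_pos (by linarith)) (by norm_num))
      (div_pos (Real.log_pos one_lt_two) (by norm_num))
  · obtain ⟨n, rfl⟩ := Nat.exists_eq_add_of_le' hd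
    obtain ⟨k, rfl⟩ := Nat.exists_eq_add_of_le' hk
    rw [ratio n k σ hσ h]
    constructor
    · refine Real.le_sqrt_of_sq_le ?_
      rw [← Real.exp_nat_mul]
      exact SphereIPM.exp_le_N hc₁ h1
    -- Since `N ≥ 1`, the crude bound `√N ≤ N` is enough here.
    · have hN1 : (1 : ℝ) ≤ SphereIPM.N (n + 2) (k + 1) := by
        exact_mod_cast (SphereIPM.two_le_N n k).trans' one_le_two
      refine (Real.sqrt_le_iff.2 ⟨by linarith, by nlinarith⟩).trans ((SphereIPM.N_le_exp n k).trans
        (Real.exp_le_exp.2 ?_))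
      rw [add_mul, one_mul]
      linarith
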